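/- Let $G$ be a finite elementary abelian $2$-group (a finite abelian group in which $g+g=0$ for every $g$). For subsets $A,B\subseteq G$ write $A+B=\{a+b\colon a\in A,\ b\in B\}$. The affine span of a non-empty set $A\subseteq G$ is the smallest coset (of any subgroup of $G$) containing $A$. For $g\in G$ let $\nu_{A,B}(g)$ be the number of pairs $(a,b)\in A\times B$ with $a+b=g$, and let $\mu_{A,B}=\min\{\nu_{A,B}(g)\colon g\in A+B\}$. Let $A$ and $B$ be non-empty subsets of $G$ whose affine spans both equal $G$. If $|A+B|<\min\{|A|+|B|,\,|G|\}$, then the complement of $A+B$ in $G$ is contained in a coset of a subgroup of $G$ of index $8$; consequently, $|A+B|\ge\frac78\,|G|$. Moreover, if $\mu_{A,B}=1$, then the containment is strict: the complement of $A+B$ is a proper subset of every coset of an index-$8$ subgroup that contains it. -/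

import Mathlib

open scoped Pointwise

namespace SmallSumset

/-- `C` is a coset of the subgroup `H`. -/
def IsCosetOf {G : Type*} [AddCommGroup G] (H : AddSubgroup G) (C : Set G) : Prop :=
  ∃ g : G, C = g +ᵥ (H : Set G)

/-- The affine span of `A`: the smallest coset (of any subgroup) that contains `A`, realised as
the intersection of all such cosets. Only used for non-empty `A`, for which this intersection is
itself a coset. -/
def affSpan {G : Type*} [AddCommGroup G] (A : Set G) : Set G :=
  ⋂₀ {C : Set G | (∃ H : AddSubgroup G, IsCosetOf H C) ∧ A ⊆ C}

/-- The number of representations of `g` as `a + b` with `a ∈ A` and `b ∈ B`. -/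
def nu {G : Type*} [AddCommGroup G] [DecidableEq G] (A B : Finset G) (g : G) : ℕ :=
  ((A ×ˢ B).filter (fun p : G × G => p.1 + p.2 = g)).card

/-- The smallest number of representations of an element of `A + B`
(a genuine minimum when `A` and `B` are non-empty). -/
noncomputable def mu {G : Type*} [AddCommGroup G] [DecidableEq G] (A B : Finset G) : ℕ :=
  sInf {m : ℕ | ∃ g ∈ A + B, nu A B g = m}

end SmallSumset

/-! The argument is the isoperimetric method combined with induction on |G|. The span hypothesis
enters through characters: no nonzero homomorphism to `ZMod 2` is constant on A or on B
(`Spanning`), a property inherited by images.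

Let C be the complement of A + B. In exponent two C + B misses A, so |C + B| < |C| + |B| as well. If
|C| = 1, the trivial subgroup works, since spanning sets in a group of order 2^n have more than n
elements, which forces |G| ≥ 8. Otherwise, among the X with |X| ≥ 2 and |X + B| ≤ |G| - 2, the
difference |X + B| - |X| is minimised by a subgroup K (`exists_subgroup_minimizer`). Consequently B
misses fewer than |K| elements of the union of the K-cosets that it meets.

Pass to Q = G/K. If C lies in one K-coset, a count gives |Q| ≥ 8. Otherwise, counting holes shows
that all pairs of cosets, one met by C and one by B, whose sum is not filled by C + B involve the
same coset j₀ of B (`exists_common_fiber`). Hence a point of Q in the image of C that is also a sum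
of the images of A and B is represented only through j₀. Such points can be removed by passing to
spanning subsets of the images (`exists_spanning_subpair`). The new sumset avoids the image of C, so
a subgroup found in Q pulls back to G.

For strictness, suppose C is a full coset of H of index 8. The images of A and B in G/H have four
elements each, and by parity each of their sums has two representations. Since A and B together miss
fewer than |H| points of their H-hulls, every element of A + B has more than |H| representations. -/

namespace SmallSumset

/-- A set is spanning if the only character of order two that is constant on it is trivial. -/
def Spanning {G : Type*} [AddCommGroup G] (S : Finset G) : Prop :=
  ∀ χ : G →+ ZMod 2, (∀ a ∈ S, ∀ b ∈ S, χ a = χ b) → χ = 0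

/-! ### Groups of exponent two, characters and spanning sets -/

section ExponentTwo

variable {G : Type*} [AddCommGroup G]

theorem neg_eq_self_of_add_self (hG : ∀ g : G, g + g = 0) (a : G) : -a = a :=
  neg_eq_of_add_eq_zero_left (hG a)

theorem add_add_cancel_of_add_self (hG : ∀ g : G, g + g = 0) (a b : G) : a + (a + b) = b := by
  rw [← add_assoc, hG, zero_add]

theorem exists_character_of_notMem (hG : ∀ g : G, g + g = 0) (W : AddSubgroup G) {t : G}
    (ht : t ∉ W) : ∃ χ : G →+ ZMod 2, (∀ w ∈ W, χ w = 0) ∧ χ t ≠ 0 := by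
  let _ : Module (ZMod 2) G := AddCommGroup.zmodModule (fun x => by rw [two_nsmul]; exact hG x)
  obtain ⟨f, hf, hfW⟩ := Submodule.exists_le_ker_of_notMem (p := AddSubgroup.toZModSubmodule 2 W)
    (v := t) (by simpa using ht)
  exact ⟨f.toAddMonoidHom, fun w hw => by simpa using hfW (by simpa using hw), by simpa using hf⟩

theorem card_eq_two_pow [Fintype G] (hG : ∀ g : G, g + g = 0) : ∃ n, Fintype.card G = 2 ^ n := by
  let _ : Module (ZMod 2) G := AddCommGroup.zmodModule (fun x => by rw [two_nsmul]; exact hG x)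
  exact ⟨_, by rw [Module.card_eq_pow_finrank (K := ZMod 2) (V := G), ZMod.card]⟩

/-- After translation by some s in S, the other elements of S span G over `ZMod 2`; hence there are
at least n of them. -/
theorem Spanning.lt_card [Fintype G] [DecidableEq G] (hG : ∀ g : G, g + g = 0) {S : Finset G}
    (hS : Spanning S) (hne : S.Nonempty) {n : ℕ} (hn : Fintype.card G = 2 ^ n) : n < S.card := by
  let _ : Module (ZMod 2) G := AddCommGroup.zmodModule (fun x => by rw [two_nsmul]; exact hG x)
  obtain ⟨s, hs⟩ := hne
  set T := (S.erase s).image (· + s) with hT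
  have htop : Submodule.span (ZMod 2) (T : Set G) = ⊤ := by
    by_contra h
    obtain ⟨f, hf, hfT⟩ := Submodule.exists_le_ker_of_lt_top _ (lt_top_iff_ne_top.2 h)
    apply hf
    have key : ∀ a ∈ S, f a = f s := by
      intro a ha
      by_cases has : a = s
      · rw [has]
      have : a + s ∈ (T : Set G) := by
        simp only [hT, Finset.coe_image, Set.mem_image, Finset.mem_coe, Finset.mem_erase]
        exact ⟨a, ⟨has, ha⟩, rfl⟩
      have h1 : f (a + s) = 0 := hfT (Submodule.subset_span this)
      rw [map_add] at h1
      rw [eq_neg_of_add_eq_zero_left h1, ← map_neg, neg_eq_self_of_add_self hG]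
    have := hS f.toAddMonoidHom (fun a ha b hb => by
      change f a = f b
      rw [key a ha, key b hb])
    ext x
    exact DFunLike.congr_fun this x
  have h1 : Module.finrank (ZMod 2) G ≤ T.card := by
    rw [← finrank_top (ZMod 2) G, ← htop]
    exact finrank_span_finset_le_card T
  have h2 : T.card ≤ S.card - 1 := Finset.card_image_le.trans (Finset.card_erase_of_mem hs).le
  have h3 : 0 < S.card := Finset.card_pos.2 ⟨s, hs⟩
  have h4 : Fintype.card G = 2 ^ Module.finrank (ZMod 2) G := by
    rw [Module.card_eq_pow_finrank (K := ZMod 2) (V := G), ZMod.card]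
  have h5 : n = Module.finrank (ZMod 2) G := Nat.pow_right_injective le_rfl (hn.symm.trans h4)
  omega

theorem three_le_of_two_mul_add_two_le_two_pow {n : ℕ} (h : 2 * n + 2 ≤ 2 ^ n) : 3 ≤ n := by
  by_contra hn
  interval_cases n <;> simp at h

theorem Spanning.image {Q : Type*} [AddCommGroup Q] [DecidableEq Q] {S : Finset G}
    (hS : Spanning S) (q : G →+ Q) (hq : Function.Surjective q) : Spanning (S.image q) := by
  intro χ hχ
  have := hS (χ.comp q) (fun a ha b hb => hχ _ (Finset.mem_image_of_mem q ha) _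
    (Finset.mem_image_of_mem q hb))
  ext x
  obtain ⟨y, rfl⟩ := hq x
  exact DFunLike.congr_fun this y

/-- A character constant on S puts S, hence its affine span, inside a coset of the kernel. -/
theorem spanning_of_affSpan_eq_univ {S : Finset G} (hne : S.Nonempty)
    (h : affSpan (S : Set G) = Set.univ) : Spanning S := by
  intro χ hχ
  obtain ⟨s, hs⟩ := hne
  have hsub : affSpan (S : Set G) ⊆ s +ᵥ (χ.ker : Set G) := by
    apply Set.sInter_subset_of_mem
    refine ⟨⟨χ.ker, s, rfl⟩, fun a ha => ?_⟩
    rw [Set.mem_vadd_set_iff_neg_vadd_mem]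
    simp only [vadd_eq_add, SetLike.mem_coe, AddMonoidHom.mem_ker, map_add, map_neg]
    rw [hχ s hs a ha, neg_add_cancel]
  rw [h] at hsub
  have key : ∀ x, χ x = χ s := by
    intro x
    have := hsub (Set.mem_univ x)
    rw [Set.mem_vadd_set_iff_neg_vadd_mem] at this
    simp only [vadd_eq_add, SetLike.mem_coe, AddMonoidHom.mem_ker, map_add, map_neg] at this
    exact (neg_add_eq_zero.1 this).symm
  ext x
  rw [key x, ← key 0, map_zero]; rfl

end ExponentTwo

/-! ### Fibers of a quotient map and the holes of a set in them -/

section Fibers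

variable {G Q : Type*} [AddCommGroup G] [Fintype G] [AddCommGroup Q] [DecidableEq Q] (q : G →+ Q)

/-- The fiber of `q` over `y`. -/
def fiber (y : Q) : Finset G := Finset.univ.filter (fun x => q x = y)

/-- The preimage of `T` under `q`. -/
def pre (T : Finset Q) : Finset G := Finset.univ.filter (fun x => q x ∈ T)

@[simp] theorem mem_fiber {y : Q} {x : G} : x ∈ fiber q y ↔ q x = y := by simp [fiber]

@[simp] theorem mem_pre {T : Finset Q} {x : G} : x ∈ pre q T ↔ q x ∈ T := by simp [pre]

variable {q}

theorem card_fiber (hq : Function.Surjective q) (y : Q) :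
    (fiber q y).card = (fiber q 0).card := by
  obtain ⟨g, rfl⟩ := hq y
  symm
  apply Finset.card_bij (fun x _ => g + x)
  · intro x hx
    simp_all
  · intro a _ b _ h
    exact add_left_cancel h
  · intro b hb
    refine ⟨b - g, ?_, by simp⟩
    simp_all

theorem card_pre (hq : Function.Surjective q) (T : Finset Q) :
    (pre q T).card = (fiber q 0).card * T.card := by
  rw [Finset.card_eq_sum_card_fiberwise (f := q) (t := T) (fun x hx => by simpa using hx),
    Finset.sum_congr rfl (fun y hy => ?_), Finset.sum_const, smul_eq_mul, mul_comm]
  rw [← card_fiber hq y]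
  congr 1
  ext x
  simp only [Finset.mem_filter, mem_pre, mem_fiber]
  exact ⟨fun h => h.2, fun h => ⟨h ▸ hy, h⟩⟩

theorem card_univ_eq [Fintype Q] (hq : Function.Surjective q) :
    Fintype.card G = (fiber q 0).card * Fintype.card Q := by
  rw [← Finset.card_univ (α := Q), ← card_pre hq, ← Finset.card_univ]
  congr 1
  ext x
  simp

theorem subset_pre_image (X : Finset G) : X ⊆ pre q (X.image q) := fun x hx => by
  simpa using ⟨x, hx, rfl⟩

theorem pre_singleton (y : Q) : pre q {y} = fiber q y := by
  ext; simp

variable [DecidableEq G]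

theorem pre_add (T : Finset Q) (B : Finset G) :
    pre q T + B = pre q (T + B.image q) := by
  ext x
  simp only [Finset.mem_add, mem_pre, Finset.mem_image]
  constructor
  · rintro ⟨a, ha, b, hb, rfl⟩
    exact ⟨q a, ha, q b, ⟨b, hb, rfl⟩, by simp⟩
  · rintro ⟨t, ht, _, ⟨b, hb, rfl⟩, h⟩
    exact ⟨x - b, by rwa [map_sub, ← h, add_sub_cancel_right], b, hb, by simp⟩

theorem card_fiber_sdiff_le {B : Finset G} {j : Q} (hj : j ∈ B.image q) :
    (fiber q j \ B).card ≤ (pre q (B.image q) \ B).card := by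
  apply Finset.card_le_card
  apply Finset.sdiff_subset_sdiff _ le_rfl
  intro x hx
  rw [mem_pre, (mem_fiber q).1 hx]
  exact hj

theorem card_fiber_sdiff_add_le {B : Finset G} {j p : Q} (hj : j ∈ B.image q)
    (hp : p ∈ B.image q) (hjp : j ≠ p) :
    (fiber q j \ B).card + (fiber q p \ B).card ≤ (pre q (B.image q) \ B).card := by
  rw [← Finset.card_union_of_disjoint]
  · apply Finset.card_le_card
    apply Finset.union_subset
    all_goals
      apply Finset.sdiff_subset_sdiff _ le_rfl
      intro x hx
      rw [mem_pre, (mem_fiber q).1 hx]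
      assumption
  · rw [Finset.disjoint_left]
    intro x hx hx'
    simp only [Finset.mem_sdiff, mem_fiber] at hx hx'
    exact hjp (hx.1.symm.trans hx'.1)

theorem card_pre_sdiff (hq : Function.Surjective q) (B : Finset G) :
    (pre q (B.image q) \ B).card + B.card = (fiber q 0).card * (B.image q).card := by
  rw [← card_pre hq]
  exact Finset.card_sdiff_add_card_eq_card (subset_pre_image B)

/-- If `z ∉ X + B` lies over `i + j`, then the parts of `X` and `B` over `i` and `j` are small. -/
theorem card_fiber_le_of_notMem_add (hq : Function.Surjective q) {X B : Finset G} {i j : Q} {z : G}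
    (hz : z ∉ X + B) (hzq : q z = i + j) :
    (fiber q 0).card ≤ (fiber q i \ X).card + (fiber q j \ B).card := by
  rw [← card_fiber hq i, ← Finset.card_sdiff_add_card_inter (fiber q i) X]
  apply Nat.add_le_add_left
  -- Since z is not a sum, x ↦ z - x sends the part of X over i into the holes of B over j.
  apply Finset.card_le_card_of_injOn (fun x => z - x)
  · intro x hx
    simp only [Finset.coe_inter, Set.mem_inter_iff, Finset.mem_coe, mem_fiber] at hx
    simp only [Finset.coe_sdiff, Set.mem_sdiff, Finset.mem_coe, mem_fiber, map_sub, hzq, hx.1,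
      add_sub_cancel_left, true_and]
    intro hB
    exact hz (Finset.mem_add.2 ⟨x, hx.2, _, hB, by simp⟩)
  · intro a _ b _ h
    simpa using h

/-- Subtracting an element of X over i turns the holes of X + B over i + p into holes of B over p.
-/
theorem card_fiber_add_sdiff_le {X B : Finset G} {i p : Q} (hi : i ∈ X.image q) :
    (fiber q (i + p) \ (X + B)).card ≤ (fiber q p \ B).card := by
  obtain ⟨x, hx, rfl⟩ := Finset.mem_image.1 hi
  apply Finset.card_le_card_of_injOn (fun z => z - x)
  · intro z hz
    simp only [Finset.coe_sdiff, Set.mem_sdiff, Finset.mem_coe, mem_fiber] at hz ⊢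
    refine ⟨by simp [hz.1], fun hB => hz.2 (Finset.mem_add.2 ⟨x, hx, _, hB, by simp⟩)⟩
  · intro a _ b _ h
    simpa using h

end Fibers

/-! ### Submodularity and subgroup atoms -/

section Atoms

variable {G : Type*} [AddCommGroup G] [DecidableEq G]

/-- The submodularity of `X ↦ |X + B|`. -/
theorem card_union_add_add_card_inter_add_le (X Y B : Finset G) :
    ((X ∪ Y) + B).card + ((X ∩ Y) + B).card ≤ (X + B).card + (Y + B).card := by
  rw [Finset.union_add, ← Finset.card_union_add_card_inter (X + B) (Y + B)]
  exact Nat.add_le_add_left (Finset.card_le_card Finset.inter_add_subset) _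

theorem card_le_card_add_of_nonempty {X B : Finset G} (hB : B.Nonempty) : X.card ≤ (X + B).card :=
  Finset.card_le_card_add_right hB

variable [Fintype G]

/-- In a group of exponent two, among the sets `X` with `|X| ≥ 2` and `|X + B| ≤ |G| - 2`
the minimum of `|X + B| - |X|` is attained on a subgroup. -/
theorem exists_subgroup_minimizer (hG : ∀ g : G, g + g = 0) {B X₀ : Finset G} (hB : B.Nonempty)
    (h2 : 2 ≤ X₀.card) (hX₀ : (X₀ + B).card + 2 ≤ Fintype.card G) :
    ∃ M : Finset G, ∃ K : AddSubgroup G, (∀ x, x ∈ M ↔ x ∈ K) ∧ 2 ≤ M.card ∧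
      (M + B).card + 2 ≤ Fintype.card G ∧
      ∀ X : Finset G, 2 ≤ X.card → (X + B).card + 2 ≤ Fintype.card G →
        (M + B).card + X.card ≤ (X + B).card + M.card := by
  classical
  set F : Finset (Finset G) := Finset.univ.filter
    (fun X => 2 ≤ X.card ∧ (X + B).card + 2 ≤ Fintype.card G) with hF
  have memF : ∀ X, X ∈ F ↔ 2 ≤ X.card ∧ (X + B).card + 2 ≤ Fintype.card G := by simp [hF]
  obtain ⟨M₀, hM₀, hmin₀⟩ := Finset.exists_min_image F (fun X => (X + B).card - X.card)
    ⟨X₀, (memF _).2 ⟨h2, hX₀⟩⟩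
  set F' := F.filter (fun X => (X + B).card - X.card ≤ (M₀ + B).card - M₀.card) with hF'
  -- M is an atom: a minimiser of least cardinality.
  obtain ⟨M, hM, hmin⟩ := Finset.exists_min_image F' Finset.card
    ⟨M₀, Finset.mem_filter.2 ⟨hM₀, le_rfl⟩⟩
  simp only [hF', Finset.mem_filter] at hM
  obtain ⟨hMF, hM'⟩ := hM
  -- This makes the truncated subtractions above genuine differences.
  have hle : ∀ X : Finset G, X.card ≤ (X + B).card := fun X => card_le_card_add_of_nonempty hB
  have hκ : ∀ X ∈ F, (M + B).card + X.card ≤ (X + B).card + M.card := by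
    intro X hX
    have := hmin₀ X hX
    have := hle X
    have := hle M
    omega
  have hsize : ∀ X ∈ F, (X + B).card + M.card ≤ (M + B).card + X.card → M.card ≤ X.card := by
    intro X hX h
    apply hmin
    simp only [hF', Finset.mem_filter]
    have := hle X
    have := hle M
    exact ⟨hX, by omega⟩
  have hM2 := (memF M).1 hMF
  -- the complement of `M + B` is a competitor, so `M` is not larger than it
  have hdual : M.card ≤ (M + B)ᶜ.card := by
    have hc := Finset.card_add_card_compl (M + B)
    have hsub : (M + B)ᶜ + B ⊆ Mᶜ := by
      intro x hx
      obtain ⟨c, hc, b, hb, rfl⟩ := Finset.mem_add.1 hx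
      rw [Finset.mem_compl] at hc ⊢
      intro h
      exact hc (Finset.mem_add.2 ⟨c + b, h, b, hb, by rw [add_assoc, hG, add_zero]⟩)
    have h1 := Finset.card_le_card hsub
    have h3 := Finset.card_add_card_compl M
    apply hsize
    · rw [memF]
      omega
    · omega
  -- If the intersection were proper, minimality of |M| would make its difference strictly larger
  -- than that of M. Submodularity and `hdual` then keep the union admissible, with a difference
  -- below the minimum.
  have hinter : ∀ t : G, 2 ≤ (M ∩ (t +ᵥ M)).card → t +ᵥ M = M := by
    intro t ht
    set M' := t +ᵥ M with hM'
    have hcM' : M'.card = M.card := Finset.card_vadd_finset _ _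
    have hcM'B : (M' + B).card = (M + B).card := by
      rw [hM', vadd_add_assoc, Finset.card_vadd_finset]
    have hsm := card_union_add_add_card_inter_add_le M M' B
    have hui := Finset.card_union_add_card_inter M M'
    have hIF : M ∩ M' ∈ F := by
      rw [memF]
      refine ⟨ht, ?_⟩
      have := Finset.card_le_card
        (Finset.add_subset_add_right (t := B) (Finset.inter_subset_left (s₁ := M) (s₂ := M')))
      omega
    by_contra hne
    have hlt : (M ∩ M').card < M.card := by
      apply Finset.card_lt_card
      refine ⟨Finset.inter_subset_left, fun h => hne ?_⟩
      exact (Finset.eq_of_subset_of_card_le (fun x hx => (Finset.mem_inter.1 (h hx)).2)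
        hcM'.le).symm
    have h1 := hκ _ hIF
    have h2 := hsize _ hIF
    have hc := Finset.card_add_card_compl (M + B)
    by_cases hU : ((M ∪ M') + B).card + 2 ≤ Fintype.card G
    · have := hκ (M ∪ M') ((memF _).2 ⟨by omega, hU⟩)
      omega
    · omega
  obtain ⟨m, hm⟩ : M.Nonempty := Finset.card_pos.1 (by omega)
  -- In exponent two, translation by a + b swaps a and b, so M and its translate share both.
  have hclosed : ∀ a ∈ M, ∀ b ∈ M, (a + b) +ᵥ M = M := by
    intro a ha b hb
    by_cases hab : a = b
    · rw [hab, hG, zero_vadd]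
    apply hinter
    have : ({a, b} : Finset G) ⊆ M ∩ ((a + b) +ᵥ M) := by
      intro x hx
      rw [Finset.mem_inter, Finset.mem_vadd_finset]
      rw [Finset.mem_insert, Finset.mem_singleton] at hx
      rcases hx with rfl | rfl
      · exact ⟨ha, b, hb, by rw [vadd_eq_add, add_assoc, hG, add_zero]⟩
      · exact ⟨hb, a, ha, by rw [vadd_eq_add, add_comm a, add_assoc, hG, add_zero]⟩
    calc 2 = ({a, b} : Finset G).card := (Finset.card_pair hab).symm
      _ ≤ _ := Finset.card_le_card this
  refine ⟨m +ᵥ M, ⟨⟨⟨{x | x ∈ m +ᵥ M}, ?_⟩, ?_⟩, ?_⟩, fun x => Iff.rfl, ?_⟩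
  · intro x y hx hy
    simp only [Set.mem_ofPred_eq, Finset.mem_vadd_finset, vadd_eq_add] at hx hy ⊢
    obtain ⟨a, ha, rfl⟩ := hx
    obtain ⟨b, hb, rfl⟩ := hy
    have := hclosed a ha m hm
    have hb' : (a + m) + b ∈ M := by
      have h := Finset.vadd_mem_vadd_finset (a := a + m) hb
      rwa [this] at h
    exact ⟨_, hb', by abel⟩
  · exact Finset.mem_vadd_finset.2 ⟨m, hm, hG m⟩
  · intro x hx
    rw [neg_eq_self_of_add_self hG]
    exact hx
  · have e1 : (m +ᵥ M).card = M.card := Finset.card_vadd_finset _ _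
    have e2 : ((m +ᵥ M) + B).card = (M + B).card := by
      rw [vadd_add_assoc, Finset.card_vadd_finset]
    rw [e1, e2]
    exact ⟨hM2.1, hM2.2, fun X h h' => hκ X ((memF X).2 ⟨h, h'⟩)⟩

end Atoms

/-! ### Counting holes over a minimising quotient -/

variable {G Q : Type*} [AddCommGroup G] [Fintype G] [DecidableEq G]
  [AddCommGroup Q] [Fintype Q] [DecidableEq Q]

/-- The fibers of `q` minimize `|X + B| - |X|`, and `B` misses less than a full fiber of
`q⁻¹(q(B))`. -/
structure FiberMinimal (q : G →+ Q) (B : Finset G) : Prop where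
  surj : Function.Surjective q
  two_le : 2 ≤ (fiber q 0).card
  ne_univ : B.image q ≠ Finset.univ
  le : ∀ X : Finset G, X.Nonempty → (X + B).card + 2 ≤ Fintype.card G →
    (fiber q 0).card * (B.image q).card + X.card ≤ (X + B).card + (fiber q 0).card
  lt : (fiber q 0).card * (B.image q).card < (fiber q 0).card + B.card

namespace FiberMinimal

variable {q : G →+ Q} {B X : Finset G}

theorem card_add_two_le (h : FiberMinimal q B) {T : Finset Q} (hT : T ≠ Finset.univ) :
    (pre q T).card + 2 ≤ Fintype.card G := by
  rw [card_pre h.surj, card_univ_eq h.surj]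
  have h1 : T.card + 1 ≤ Fintype.card Q := (Finset.card_lt_iff_ne_univ T).2 hT
  calc _ ≤ (fiber q 0).card * T.card + (fiber q 0).card := Nat.add_le_add_left h.two_le _
    _ = (fiber q 0).card * (T.card + 1) := by ring
    _ ≤ _ := Nat.mul_le_mul_left _ h1

theorem card_sdiff_lt (h : FiberMinimal q B) :
    (pre q (B.image q) \ B).card < (fiber q 0).card := by
  have := card_pre_sdiff h.surj B
  have := h.lt
  omega

/-- Submodularity applied to X and the fiber: their nonempty intersection has difference at least
that of the fiber, so filling the fiber does not raise the difference of X. -/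
theorem card_union_fiber_add_le (h : FiberMinimal q B) {y : Q} (hy : y ∈ X.image q) :
    ((X ∪ fiber q y) + B).card + X.card ≤ (X + B).card + (X ∪ fiber q y).card := by
  have hsm := card_union_add_add_card_inter_add_le X (fiber q y) B
  have hui := Finset.card_union_add_card_inter X (fiber q y)
  have hfB : (fiber q y + B) = pre q ({y} + B.image q) := by
    rw [← pre_singleton, pre_add]
  have hcf : (fiber q y + B).card = (fiber q 0).card * (B.image q).card := by
    rw [hfB, card_pre h.surj, Finset.card_singleton_add]
  have hne : (X ∩ fiber q y).Nonempty := by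
    obtain ⟨x, hx, rfl⟩ := Finset.mem_image.1 hy
    exact ⟨x, by simp [hx]⟩
  have hle := h.le _ hne (by
    have h1 : ((X ∩ fiber q y) + B).card ≤ (fiber q y + B).card :=
      Finset.card_le_card (Finset.add_subset_add_right Finset.inter_subset_right)
    have h2 := h.card_add_two_le h.ne_univ
    rw [card_pre h.surj] at h2
    omega)
  rw [card_fiber h.surj y] at hui
  omega

theorem card_union_pre_add_le (h : FiberMinimal q B) (Y : Finset Q) (hY : Y ⊆ X.image q) :
    ((X ∪ pre q Y) + B).card + X.card ≤ (X + B).card + (X ∪ pre q Y).card := by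
  induction Y using Finset.induction_on with
  | empty =>
    have : pre q (∅ : Finset Q) = ∅ := by ext; simp
    rw [this, Finset.union_empty]
  | insert y Y _ ih =>
    have ih := ih ((Finset.subset_insert _ _).trans hY)
    have he : X ∪ pre q (insert y Y) = (X ∪ pre q Y) ∪ fiber q y := by
      ext x
      simp only [Finset.mem_union, mem_pre, mem_fiber, Finset.mem_insert]
      tauto
    have hstep := h.card_union_fiber_add_le (X := X ∪ pre q Y) (y := y)
      (Finset.image_subset_image Finset.subset_union_left (hY (Finset.mem_insert_self _ _)))
    rw [← he] at hstep
    omega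

theorem card_image_add_lt (h : FiberMinimal q B) (hX : (X + B).card < X.card + B.card) :
    (X.image q + B.image q).card < (X.image q).card + (B.image q).card := by
  have h1 := h.card_union_pre_add_le (X.image q) le_rfl
  rw [Finset.union_eq_right.2 (subset_pre_image X), pre_add, card_pre h.surj,
    card_pre h.surj] at h1
  have h2 : B.card ≤ (fiber q 0).card * (B.image q).card := by
    rw [← card_pre h.surj]
    exact Finset.card_le_card (subset_pre_image B)
  have h3 : (fiber q 0).card * (X.image q + B.image q).card <
      (fiber q 0).card * ((X.image q).card + (B.image q).card) := by
    rw [mul_add]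
    omega
  exact lt_of_mul_lt_mul_left h3 (Nat.zero_le _)

/-- Minimality tested on full preimages gives a Cauchy–Davenport bound in Q. -/
theorem le_card_add_image (h : FiberMinimal q B) {T : Finset Q} (hT : T.Nonempty)
    (hne : T + B.image q ≠ Finset.univ) :
    T.card + (B.image q).card ≤ (T + B.image q).card + 1 := by
  have hne' : (pre q T).Nonempty := by
    rw [← Finset.card_pos, card_pre h.surj]
    exact Nat.mul_pos (by have := h.two_le; omega) (Finset.card_pos.2 hT)
  have h1 := h.le _ hne' (by rw [pre_add]; exact h.card_add_two_le hne)
  rw [pre_add, card_pre h.surj, card_pre h.surj] at h1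
  have h2 : 0 < (fiber q 0).card := by have := h.two_le; omega
  refine le_of_mul_le_mul_left (?_ : (fiber q 0).card * _ ≤ (fiber q 0).card * _) h2
  rw [mul_add, mul_add]
  omega

/-- The counting inequality obtained by filling up all fibers of `X` over `Y`. -/
theorem card_sdiff_add_card_sdiff_lt (h : FiberMinimal q B) (hX : (X + B).card < X.card + B.card)
    (ht : (X.image q + B.image q).card + 1 = (X.image q).card + (B.image q).card)
    {Y : Finset Q} (hY : Y ⊆ X.image q) :
    (pre q (B.image q) \ B).card + (pre q (X.image q) \ (X ∪ pre q Y)).card <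
      (fiber q 0).card +
        (pre q (X.image q + B.image q) \ ((X ∪ pre q Y) + B)).card := by
  have h1 := h.card_union_pre_add_le Y hY
  have h2 := card_pre_sdiff h.surj B
  have hZ : X ∪ pre q Y ⊆ pre q (X.image q) := by
    apply Finset.union_subset (subset_pre_image X)
    intro x hx
    rw [mem_pre] at hx ⊢
    exact hY hx
  have hZB : (X ∪ pre q Y) + B ⊆ pre q (X.image q + B.image q) := by
    rw [← pre_add]
    exact Finset.add_subset_add_right hZ
  have h3 := Finset.card_sdiff_add_card_eq_card hZ
  have h4 := Finset.card_sdiff_add_card_eq_card hZB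
  rw [card_pre h.surj] at h3 h4
  have h5 : (fiber q 0).card * ((X.image q + B.image q).card + 1) =
    (fiber q 0).card * ((X.image q).card + (B.image q).card) := by rw [ht]
  rw [mul_add, mul_add] at h5
  omega

/-- Filling every fiber of X except the one over i leaves holes only over P, which has at most one
point. A hole over i + j' forces at least |K| holes in X over i and B over j' together. The counting
inequality rules this out unless i + j' is that point. -/
theorem eq_of_notMem_add (h : FiberMinimal q B) (hX : (X + B).card < X.card + B.card)
    (ht : (X.image q + B.image q).card + 1 = (X.image q).card + (B.image q).card)
    (h2 : 2 ≤ (X.image q).card) {i j : Q} (hi : i ∈ X.image q) (hj : j ∈ B.image q) {z : G}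
    (hz : z ∉ X + B) (hzq : q z = i + j) :
    i + j ∉ (X.image q).erase i + B.image q ∧
      ∀ j' ∈ B.image q, ∀ z', z' ∉ X + B → q z' = i + j' → j' = j := by
  set Y := (X.image q).erase i with hYdef
  have hYX : Y ⊆ X.image q := Finset.erase_subset _ _
  have hYc : Y.card + 1 = (X.image q).card := Finset.card_erase_add_one hi
  have hYne : Y.Nonempty := Finset.card_pos.1 (by omega)
  set W := Y + B.image q with hW
  set P := (X.image q + B.image q) \ W with hP
  have hWs : W ⊆ X.image q + B.image q := Finset.add_subset_add_right hYX
  have hPc : P.card ≤ 1 := by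
    have h3 := Finset.card_sdiff_add_card_eq_card hWs
    by_cases hWu : W = Finset.univ
    · rw [hP, hWu, Finset.sdiff_eq_empty_iff_subset.2 (Finset.subset_univ _)]
      simp
    · have := h.le_card_add_image hYne hWu
      rw [← hW] at this
      rw [← hP] at h3
      omega
  have hPmem : ∀ y ∈ P, ∃ p ∈ B.image q, y = i + p := by
    intro y hy
    obtain ⟨hy1, hy2⟩ := Finset.mem_sdiff.1 hy
    obtain ⟨a, ha, b, hb, rfl⟩ := Finset.mem_add.1 hy1
    by_cases hai : a = i
    · exact ⟨b, hb, by rw [hai]⟩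
    · exact absurd (Finset.add_mem_add (Finset.mem_erase.2 ⟨hai, ha⟩) hb) hy2
  have hmaster := h.card_sdiff_add_card_sdiff_lt hX ht hYX
  have hR : (pre q (X.image q) \ (X ∪ pre q Y)) = fiber q i \ X := by
    ext x
    simp only [Finset.mem_sdiff, mem_pre, Finset.mem_union, mem_fiber, hYdef, Finset.mem_erase]
    constructor
    · rintro ⟨hx, hx'⟩
      by_contra hcon
      tauto
    · rintro ⟨rfl, hx⟩
      exact ⟨hi, by tauto⟩
  rw [hR] at hmaster
  have hM : ∀ x ∈ pre q (X.image q + B.image q) \ ((X ∪ pre q Y) + B), q x ∈ P ∧ x ∉ X + B := by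
    intro x hx
    obtain ⟨hx1, hx2⟩ := Finset.mem_sdiff.1 hx
    rw [Finset.union_add, pre_add, Finset.mem_union, not_or, mem_pre] at hx2
    exact ⟨Finset.mem_sdiff.2 ⟨(mem_pre q).1 hx1, hx2.2⟩, hx2.1⟩
  have key : ∀ j' ∈ B.image q, ∀ z', z' ∉ X + B → q z' = i + j' → i + j' ∈ P := by
    intro j' hj' z' hz' hzq'
    have hρ := card_fiber_le_of_notMem_add h.surj hz' hzq'
    have hβ := card_fiber_sdiff_le (q := q) hj'
    rcases P.eq_empty_or_nonempty with hPe | ⟨y, hy⟩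
    · have : pre q (X.image q + B.image q) \ ((X ∪ pre q Y) + B) = ∅ := by
        rw [Finset.eq_empty_iff_forall_notMem]
        intro x hx
        have := (hM x hx).1
        rw [hPe] at this
        simp at this
      rw [this, Finset.card_empty] at hmaster
      omega
    · obtain ⟨p, hp, rfl⟩ := hPmem y hy
      by_cases hpj : j' = p
      · rwa [hpj]
      exfalso
      have hsub : pre q (X.image q + B.image q) \ ((X ∪ pre q Y) + B) ⊆
          fiber q (i + p) \ (X + B) := by
        intro x hx
        have := hM x hx
        rw [Finset.mem_sdiff, mem_fiber]
        exact ⟨Finset.card_le_one.1 hPc _ this.1 _ hy, this.2⟩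
      have h3 := Finset.card_le_card hsub
      have h4 := card_fiber_add_sdiff_le (q := q) (X := X) (B := B) (p := p) hi
      have h5 := card_fiber_sdiff_add_le hj' hp hpj
      omega
  have hjP := key j hj z hz hzq
  refine ⟨(Finset.mem_sdiff.1 hjP).2, fun j' hj' z' hz' hzq' => ?_⟩
  exact add_left_cancel (Finset.card_le_one.1 hPc _ (key j' hj' z' hz' hzq') _ hjP)

/-- If j₁ ≠ j₂, then i₁ ≠ i₂; fill all fibers but those two. The counting inequality leaves X fewer
than |K| holes there, while pigeonhole in both fibers demands more than |K|, because B has fewer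
than |K| holes in all. -/
theorem eq_of_notMem_add_of_notMem_add (h : FiberMinimal q B)
    (hX : (X + B).card < X.card + B.card)
    (ht : (X.image q + B.image q).card + 1 = (X.image q).card + (B.image q).card)
    (h2 : 2 ≤ (X.image q).card) {i₁ j₁ i₂ j₂ : Q} (hi₁ : i₁ ∈ X.image q) (hj₁ : j₁ ∈ B.image q)
    (hi₂ : i₂ ∈ X.image q) (hj₂ : j₂ ∈ B.image q) {z₁ z₂ : G}
    (hz₁ : z₁ ∉ X + B) (hzq₁ : q z₁ = i₁ + j₁) (hz₂ : z₂ ∉ X + B) (hzq₂ : q z₂ = i₂ + j₂) :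
    j₁ = j₂ := by
  by_contra hne
  have s₁ := (h.eq_of_notMem_add hX ht h2 hi₁ hj₁ hz₁ hzq₁).2
  have s₂ := (h.eq_of_notMem_add hX ht h2 hi₂ hj₂ hz₂ hzq₂).2
  have hi : i₁ ≠ i₂ := by
    rintro rfl
    exact hne (s₁ j₂ hj₂ z₂ hz₂ hzq₂).symm
  set Y := ((X.image q).erase i₁).erase i₂ with hYdef
  have hYX : Y ⊆ X.image q := (Finset.erase_subset _ _).trans (Finset.erase_subset _ _)
  have hmaster := h.card_sdiff_add_card_sdiff_lt hX ht hYX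
  have hR : (fiber q i₁ \ X) ∪ (fiber q i₂ \ X) ⊆ pre q (X.image q) \ (X ∪ pre q Y) := by
    intro x
    simp only [Finset.mem_sdiff, mem_pre, Finset.mem_union, mem_fiber, hYdef, Finset.mem_erase]
    rintro (⟨rfl, hx⟩ | ⟨rfl, hx⟩)
    · exact ⟨hi₁, by tauto⟩
    · exact ⟨hi₂, by tauto⟩
  have hRc := Finset.card_le_card hR
  rw [Finset.card_union_of_disjoint (by
    rw [Finset.disjoint_left]
    intro x hx hx'
    simp only [Finset.mem_sdiff, mem_fiber] at hx hx'
    exact hi (hx.1.symm.trans hx'.1))] at hRc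
  have hM : pre q (X.image q + B.image q) \ ((X ∪ pre q Y) + B) ⊆
      (fiber q (i₁ + j₁) \ (X + B)) ∪ (fiber q (i₂ + j₂) \ (X + B)) := by
    intro x hx
    obtain ⟨hx1, hx2⟩ := Finset.mem_sdiff.1 hx
    rw [Finset.union_add, pre_add, Finset.mem_union, not_or, mem_pre] at hx2
    obtain ⟨a, ha, b, hb, hab⟩ := Finset.mem_add.1 ((mem_pre q).1 hx1)
    rw [Finset.mem_union, Finset.mem_sdiff, Finset.mem_sdiff, mem_fiber, mem_fiber]
    by_cases ha1 : a = i₁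
    · subst ha1
      exact Or.inl ⟨by rw [← hab, s₁ b hb x hx2.1 hab.symm], hx2.1⟩
    by_cases ha2 : a = i₂
    · subst ha2
      exact Or.inr ⟨by rw [← hab, s₂ b hb x hx2.1 hab.symm], hx2.1⟩
    · exact absurd (hab ▸ Finset.add_mem_add (Finset.mem_erase.2 ⟨ha2, Finset.mem_erase.2
        ⟨ha1, ha⟩⟩) hb) hx2.2
  have hMc := (Finset.card_le_card hM).trans (Finset.card_union_le _ _)
  have b₁ := card_fiber_add_sdiff_le (q := q) (X := X) (B := B) (p := j₁) hi₁
  have b₂ := card_fiber_add_sdiff_le (q := q) (X := X) (B := B) (p := j₂) hi₂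
  have r₁ := card_fiber_le_of_notMem_add h.surj hz₁ hzq₁
  have r₂ := card_fiber_le_of_notMem_add h.surj hz₂ hzq₂
  have hβ := card_fiber_sdiff_add_le hj₁ hj₂ hne
  have := h.card_sdiff_lt
  omega

/-- All pairs of fibers whose sum lies over a fiber not covered by `X + B` share the same fiber
of `B`. -/
theorem exists_common_fiber (h : FiberMinimal q B) (hX : (X + B).card < X.card + B.card)
    (ht : (X.image q + B.image q).card + 1 = (X.image q).card + (B.image q).card)
    (h2 : 2 ≤ (X.image q).card) :
    ∃ j₀, ∀ i ∈ X.image q, ∀ j ∈ B.image q, ∀ z, z ∉ X + B → q z = i + j → j = j₀ := by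
  by_cases hex : ∃ i ∈ X.image q, ∃ j ∈ B.image q, ∃ z, z ∉ X + B ∧ q z = i + j
  · obtain ⟨i₀, hi₀, j₀, hj₀, z₀, hz₀, hzq₀⟩ := hex
    exact ⟨j₀, fun i hi j hj z hz hzq =>
      h.eq_of_notMem_add_of_notMem_add hX ht h2 hi hj hi₀ hj₀ hz hzq hz₀ hzq₀⟩
  · push Not at hex
    exact ⟨0, fun i hi j hj z hz hzq => absurd hzq (hex i hi j hj z hz)⟩

end FiberMinimal

/-! ### Stabilizers and removal of points from a sumset -/

variable {Q : Type*} [AddCommGroup Q]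

theorem sub_eq_sub_of_ne : ∀ a b c d : ZMod 2, a ≠ b → c ≠ d → a - c = b - d := by decide

theorem add_eq_add_of_ne : ∀ a b c d : ZMod 2, a ≠ b → c ≠ d → a + c = b + d := by decide

theorem Spanning.exists_ne {S : Finset Q} (hS : Spanning S) {χ : Q →+ ZMod 2} (hχ : χ ≠ 0)
    (c : ZMod 2) : ∃ s ∈ S, χ s ≠ c := by
  by_contra hcon
  push Not at hcon
  exact hχ (hS χ (fun a ha b hb => by rw [hcon a ha, hcon b hb]))

theorem exists_apply_eq_of_ne {S : Finset Q} {χ : Q →+ ZMod 2} {a b : Q} (ha : a ∈ S) (hb : b ∈ S)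
    (hab : χ a ≠ χ b) (e : ZMod 2) : ∃ s ∈ S, χ s = e := by
  have : ∀ x y e : ZMod 2, x ≠ y → x = e ∨ y = e := by decide
  rcases this _ _ e hab with h | h
  exacts [⟨a, ha, h⟩, ⟨b, hb, h⟩]

variable [DecidableEq Q]

/-- By cardinality every translate of U by an element of V is all of U + V. -/
theorem vadd_eq_self_of_card_add_le {U V : Finset Q} (h : (U + V).card ≤ U.card) {v v' : Q}
    (hv : v ∈ V) (hv' : v' ∈ V) : (v - v') +ᵥ U = U := by
  have key : ∀ w ∈ V, w +ᵥ U = U + V := by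
    intro w hw
    apply Finset.eq_of_subset_of_card_le
    · intro x hx
      obtain ⟨u, hu, rfl⟩ := Finset.mem_vadd_finset.1 hx
      rw [vadd_eq_add, add_comm w u]
      exact Finset.add_mem_add hu hw
    · rwa [Finset.card_vadd_finset]
  rw [sub_eq_neg_add, add_vadd, key v hv, ← key v' hv', neg_vadd_vadd]

/-- If `x` and `u + v` agree under all characters that are trivial on the stabilizer of `U`, then
`x ∈ U + V`. -/
theorem mem_add_of_characters (hG : ∀ g : Q, g + g = 0) {U V : Finset Q} {u v x : Q} (hu : u ∈ U)
    (hv : v ∈ V)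
    (h : ∀ χ : Q →+ ZMod 2, (∀ t : Q, t +ᵥ U = U → χ t = 0) → χ x = χ (u + v)) :
    x ∈ U + V := by
  by_cases hx : x - (u + v) ∈ AddAction.stabilizer Q U
  · rw [AddAction.mem_stabilizer_iff] at hx
    have := Finset.vadd_mem_vadd_finset (a := x - (u + v)) hu
    rw [hx, vadd_eq_add] at this
    exact Finset.mem_add.2 ⟨_, this, v, hv, by abel⟩
  · obtain ⟨χ, hχ, hne⟩ := exists_character_of_notMem hG _ hx
    exfalso
    apply hne
    rw [map_sub, sub_eq_zero]
    exact h χ (fun t ht => hχ t (AddAction.mem_stabilizer_iff.2 ht))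

/-- A set spanning up to one element `j` admits at most one nontrivial character constant off `j`. -/
theorem eq_zero_or_eq_of_erase {B : Finset Q} (hB : Spanning B) {j : Q}
    {φ : Q →+ ZMod 2} (hφ0 : φ ≠ 0) (hφ : ∀ b ∈ B.erase j, ∀ b' ∈ B.erase j, φ b = φ b')
    {χ : Q →+ ZMod 2} (hχ : ∀ b ∈ B.erase j, ∀ b' ∈ B.erase j, χ b = χ b') : χ = 0 ∨ χ = φ := by
  have key : ∀ θ : Q →+ ZMod 2, (∀ b ∈ B.erase j, ∀ b' ∈ B.erase j, θ b = θ b') →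
      (∀ b ∈ B.erase j, θ j = θ b) → θ = 0 := by
    intro θ h1 h2
    apply hB
    intro a ha b hb
    by_cases haj : a = j <;> by_cases hbj : b = j
    · rw [haj, hbj]
    · rw [haj]; exact h2 b (Finset.mem_erase.2 ⟨hbj, hb⟩)
    · rw [hbj]; exact (h2 a (Finset.mem_erase.2 ⟨haj, ha⟩)).symm
    · exact h1 a (Finset.mem_erase.2 ⟨haj, ha⟩) b (Finset.mem_erase.2 ⟨hbj, hb⟩)
  by_cases h : ∀ b ∈ B.erase j, χ j = χ b
  · exact Or.inl (key χ hχ h)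
  · right
    push Not at h
    obtain ⟨b₀, hb₀, hχb⟩ := h
    have hφb : φ j ≠ φ b₀ := fun h => hφ0 (key φ hφ (fun b hb => h.trans (hφ b₀ hb₀ b hb)))
    rw [← sub_eq_zero]
    apply key
    · intro b hb b' hb'
      simp only [AddMonoidHom.sub_apply]
      rw [hχ b hb b' hb', hφ b hb b' hb']
    · intro b hb
      simp only [AddMonoidHom.sub_apply]
      rw [hχ b hb b₀ hb₀, hφ b hb b₀ hb₀]
      exact sub_eq_sub_of_ne _ _ _ _ hχb hφb

/-- Sets on which two characters take both values: if their sumset is small, then it is a union of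
cosets of the intersection of the kernels. -/
theorem mem_add_of_two_characters (hG : ∀ g : Q, g + g = 0) {U V : Finset Q} {φ ψ : Q →+ ZMod 2}
    {s t : ZMod 2} (hψU : ∀ u ∈ U, ψ u = s) (hφV : ∀ v ∈ V, φ v = t)
    (hφU : ∀ e, ∃ u ∈ U, φ u = e) (hψV : ∀ e, ∃ v ∈ V, ψ v = e)
    (hV : ∀ χ : Q →+ ZMod 2, (∀ v ∈ V, ∀ v' ∈ V, χ v = χ v') → χ = 0 ∨ χ = φ)
    (hc : (U + V).card ≤ U.card + V.card) (x : Q) : x ∈ U + V := by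
  set U' : ZMod 2 → Finset Q := fun e => U.filter (fun u => φ u = e) with hU'
  set V' : ZMod 2 → Finset Q := fun e => V.filter (fun v => ψ v = e) with hV'
  have memU : ∀ e u, u ∈ U' e ↔ u ∈ U ∧ φ u = e := by simp [hU']
  have memV : ∀ e v, v ∈ V' e ↔ v ∈ V ∧ ψ v = e := by simp [hV']
  have hU'ne : ∀ e, (U' e).Nonempty := fun e => by
    obtain ⟨u, hu, h⟩ := hφU e
    exact ⟨u, (memU e u).2 ⟨hu, h⟩⟩
  have hV'ne : ∀ e, (V' e).Nonempty := fun e => by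
    obtain ⟨u, hu, h⟩ := hψV e
    exact ⟨u, (memV e u).2 ⟨hu, h⟩⟩
  have htwo : ∀ e : ZMod 2, e = 0 ∨ e = 1 := by decide
  have hUc : U.card = (U' 0).card + (U' 1).card := by
    rw [Finset.card_eq_sum_card_fiberwise (f := φ) (t := Finset.univ) (fun _ _ => by simp)]
    exact Fin.sum_univ_two _
  have hVc : V.card = (V' 0).card + (V' 1).card := by
    rw [Finset.card_eq_sum_card_fiberwise (f := ψ) (t := Finset.univ) (fun _ _ => by simp)]
    exact Fin.sum_univ_two _
  -- The four partial sums are separated by the values of φ and ψ.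
  have hsum : (U' 0 + V' 0).card + (U' 0 + V' 1).card + ((U' 1 + V' 0).card + (U' 1 + V' 1).card)
      ≤ (U + V).card := by
    have hbi : (Finset.univ.biUnion (fun p : ZMod 2 × ZMod 2 => U' p.1 + V' p.2)).card ≤
        (U + V).card := by
      apply Finset.card_le_card
      intro y hy
      obtain ⟨p, -, hp⟩ := Finset.mem_biUnion.1 hy
      exact Finset.add_subset_add (Finset.filter_subset _ _) (Finset.filter_subset _ _) hp
    rw [Finset.card_biUnion] at hbi
    · rw [Fintype.sum_prod_type] at hbi
      refine le_trans (le_of_eq ?_) hbi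
      symm
      refine (Fin.sum_univ_two _).trans ?_
      exact congrArg₂ _ (Fin.sum_univ_two _) (Fin.sum_univ_two _)
    · intro p _ p' _ hne
      rw [Function.onFun, Finset.disjoint_left]
      intro y hy hy'
      apply hne
      have key : ∀ p : ZMod 2 × ZMod 2, y ∈ U' p.1 + V' p.2 → φ y = p.1 + t ∧ ψ y = s + p.2 := by
        intro p hp
        obtain ⟨u, hu, v, hv, rfl⟩ := Finset.mem_add.1 hp
        rw [memU] at hu
        rw [memV] at hv
        rw [map_add, map_add, hu.2, hv.2, hψU u hu.1, hφV v hv.1]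
        exact ⟨rfl, rfl⟩
      have h1 := key p hy
      have h2 := key p' hy'
      exact Prod.ext (add_right_cancel (h1.1.symm.trans h2.1))
        (add_left_cancel (h1.2.symm.trans h2.2))
  have hUle : ∀ e f, (U' e).card ≤ (U' e + V' f).card := fun e f =>
    card_le_card_add_of_nonempty (hV'ne f)
  have hVle : ∀ e f, (V' f).card ≤ (U' e + V' f).card := fun e f =>
    Finset.card_le_card_add_left (hU'ne e)
  -- Bounding the four sums below by the four pieces, in two different matchings, makes every bound
  -- an equality.
  have heq : ∀ e f, (U' e + V' f).card ≤ (U' e).card := by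
    have h1 := hUle 0 0
    have h2 := hUle 0 1
    have h3 := hUle 1 0
    have h4 := hUle 1 1
    have h5 := hVle 0 0
    have h6 := hVle 0 1
    have h7 := hVle 1 0
    have h8 := hVle 1 1
    intro e f
    rcases htwo e with rfl | rfl <;> rcases htwo f with rfl | rfl <;> omega
  obtain ⟨u, hu⟩ := hU'ne (φ x - t)
  obtain ⟨v, hv⟩ := hV'ne (ψ x - s)
  refine Finset.add_subset_add (Finset.filter_subset _ _) (Finset.filter_subset _ _)
    (mem_add_of_characters hG hu hv ?_)
  -- θ is constant on each half of V, so θ or θ - ψ is constant on V; thus θ is a combination of φ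
  -- and ψ, and both agree at x and u + v.
  intro θ hθ
  have hconst : ∀ f, ∀ v ∈ V' f, ∀ v' ∈ V' f, θ v = θ v' := by
    intro f v hv v' hv'
    have := hθ _ (vadd_eq_self_of_card_add_le (heq _ f) hv hv')
    rwa [map_sub, sub_eq_zero] at this
  rw [memU] at hu
  rw [memV] at hv
  have hφx : φ x = φ (u + v) := by rw [map_add, hu.2, hφV v hv.1, sub_add_cancel]
  have hψx : ψ x = ψ (u + v) := by rw [map_add, hv.2, hψU u hu.1, add_sub_cancel]
  obtain ⟨v₀, hv₀⟩ := hV'ne 0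
  obtain ⟨v₁, hv₁⟩ := hV'ne 1
  have hall : ∀ v ∈ V, θ v = if ψ v = 0 then θ v₀ else θ v₁ := by
    intro v hv
    rcases htwo (ψ v) with h | h
    · rw [if_pos h]
      exact hconst 0 v ((memV _ _).2 ⟨hv, h⟩) v₀ hv₀
    · rw [if_neg (by rw [h]; decide)]
      exact hconst 1 v ((memV _ _).2 ⟨hv, h⟩) v₁ hv₁
  by_cases hv01 : θ v₀ = θ v₁
  · rcases hV θ (fun v hv v' hv' => by rw [hall v hv, hall v' hv', hv01, ite_self, ite_self])
      with h | h
    · rw [h]; rfl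
    · rw [h]; exact hφx
  · have hcase : ∀ a b c d : ZMod 2, a ≠ b →
        (if c = 0 then a else b) - c = (if d = 0 then a else b) - d := by decide
    have hsub : ∀ y, (θ - ψ) y = θ y - ψ y := fun y => rfl
    rcases hV (θ - ψ) (fun v hv v' hv' => by
      rw [hsub, hsub, hall v hv, hall v' hv']
      exact hcase _ _ _ _ hv01) with h | h
    · rw [sub_eq_zero.1 h]; exact hψx
    · rw [sub_eq_iff_eq_add.1 h, AddMonoidHom.add_apply, AddMonoidHom.add_apply, hφx, hψx]

/-- If all representations of the elements of `X ⊆ A + B` use `j ∈ B`, then `X` can be removed from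
the sumset by passing to spanning subsets of `A` and `B`, keeping the sumset small. -/
theorem exists_spanning_subpair (hG : ∀ g : Q, g + g = 0) {A B X : Finset Q} (hA : Spanning A)
    (hB : Spanning B) (hAB : (A + B).card < A.card + B.card) {j : Q} (hj : j ∈ B)
    (hX : X.Nonempty) (hXs : X ⊆ A + B) (hXj : ∀ a ∈ A, ∀ b ∈ B, a + b ∈ X → b = j) :
    ∃ A' B' : Finset Q, Spanning A' ∧ Spanning B' ∧ A' + B' ⊆ (A + B) \ X ∧
      (A' + B').card < A'.card + B'.card := by
  set I := A.filter (fun a => a + j ∈ X) with hI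
  have memI : ∀ a, a ∈ I ↔ a ∈ A ∧ a + j ∈ X := by simp [hI]
  have hIc : I.card = X.card := by
    apply Finset.card_bij (fun a _ => a + j)
    · intro a ha
      exact ((memI a).1 ha).2
    · intro a _ b _ h
      exact add_right_cancel h
    · intro x hx
      obtain ⟨a, ha, b, hb, rfl⟩ := Finset.mem_add.1 (hXs hx)
      have := hXj a ha b hb hx
      subst this
      exact ⟨a, (memI a).2 ⟨ha, hx⟩, rfl⟩
  have hXpos : 0 < X.card := Finset.card_pos.2 hX
  set A₁ := A \ I with hA₁
  set B₁ := B.erase j with hB₁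
  have hA₁c : A₁.card + X.card = A.card := by
    rw [← hIc]
    exact Finset.card_sdiff_add_card_eq_card (Finset.filter_subset _ _)
  have hB₁c : B₁.card + 1 = B.card := Finset.card_erase_add_one hj
  have hTc : ((A + B) \ X).card + X.card = (A + B).card := Finset.card_sdiff_add_card_eq_card hXs
  have hs₁ : A + B₁ ⊆ (A + B) \ X := by
    intro y hy
    obtain ⟨a, ha, b, hb, rfl⟩ := Finset.mem_add.1 hy
    rw [hB₁, Finset.mem_erase] at hb
    exact Finset.mem_sdiff.2 ⟨Finset.add_mem_add ha hb.2, fun h => hb.1 (hXj a ha b hb.2 h)⟩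
  have hs₂ : A₁ + B ⊆ (A + B) \ X := by
    intro y hy
    obtain ⟨a, ha, b, hb, rfl⟩ := Finset.mem_add.1 hy
    rw [hA₁, Finset.mem_sdiff] at ha
    refine Finset.mem_sdiff.2 ⟨Finset.add_mem_add ha.1 hb, fun h => ha.2 ?_⟩
    have := hXj a ha.1 b hb h
    subst this
    exact (memI a).2 ⟨ha.1, h⟩
  by_cases hspB : Spanning B₁
  · refine ⟨A, B₁, hA, hspB, hs₁, ?_⟩
    have := Finset.card_le_card hs₁
    omega
  by_cases hspA : Spanning A₁
  · refine ⟨A₁, B, hspA, hB, hs₂, ?_⟩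
    have := Finset.card_le_card hs₂
    omega
  -- Let φ be constant on B₁ and ψ on A₁. The remaining sumset has size at most |A₁| + |B₁|; in each
  -- case below this is so tight that it would have to contain a point of X.
  exfalso
  unfold Spanning at hspB hspA
  push Not at hspB hspA
  obtain ⟨φ, hφ, hφ0⟩ := hspB
  obtain ⟨ψ, hψ, hψ0⟩ := hspA
  have hB₁χ : ∀ χ : Q →+ ZMod 2, (∀ b ∈ B₁, ∀ b' ∈ B₁, χ b = χ b') → χ = 0 ∨ χ = φ :=
    fun χ hχ => eq_zero_or_eq_of_erase hB hφ0 hφ hχ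
  obtain ⟨b₀, hb₀⟩ : B₁.Nonempty := by
    obtain ⟨b, hb, hbj⟩ := hB.exists_ne hφ0 (φ j)
    exact ⟨b, Finset.mem_erase.2 ⟨fun h => hbj (by rw [h]), hb⟩⟩
  have hφj : φ j ≠ φ b₀ := by
    obtain ⟨b, hb, hbj⟩ := hB.exists_ne hφ0 (φ b₀)
    by_cases h : b = j
    · rwa [← h]
    · exact absurd (hφ b (Finset.mem_erase.2 ⟨h, hb⟩) b₀ hb₀) hbj
  have hT : ((A + B) \ X).card ≤ A₁.card + B₁.card := by omega
  rcases A₁.eq_empty_or_nonempty with hA₁e | ⟨a₀, ha₀⟩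
  · have h1 : (B₁ + A).card ≤ B₁.card := by
      rw [add_comm]
      have := Finset.card_le_card hs₁
      rw [hA₁e, Finset.card_empty] at hT
      omega
    obtain ⟨x, hx⟩ := hX
    obtain ⟨a, ha, b, hb, hab⟩ := Finset.mem_add.1 (hXs hx)
    have hxm : x ∈ B₁ + A := by
      apply mem_add_of_characters hG hb₀ ha
      intro χ hχ
      have : χ = 0 := hA χ (fun a ha a' ha' => by
        have := hχ _ (vadd_eq_self_of_card_add_le h1 ha ha')
        rwa [map_sub, sub_eq_zero] at this)
      rw [this]; rfl
    rw [add_comm] at hxm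
    exact (Finset.mem_sdiff.1 (hs₁ hxm)).2 hx
  have hs₃ : A₁ + B₁ ⊆ (A + B) \ X :=
    (Finset.add_subset_add_left (Finset.erase_subset _ _)).trans hs₂
  by_cases hpar : ∀ a ∈ A₁, φ a = φ a₀
  -- φ is constant on A₁: it separates A₁ + B₁ from i + B₁, leaving |A₁ + B₁| ≤ |A₁|. So A₁ + B₁
  -- contains a full coset of ker φ, and that coset contains i + j.
  · obtain ⟨i, hi, hia⟩ := hA.exists_ne hφ0 (φ a₀)
    have hiI : i ∈ I := by
      by_contra h
      exact hia (hpar i (Finset.mem_sdiff.2 ⟨hi, h⟩))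
    have hdisj : Disjoint (A₁ + B₁) (i +ᵥ B₁) := by
      rw [Finset.disjoint_left]
      intro y hy hy'
      obtain ⟨a, ha, b, hb, rfl⟩ := Finset.mem_add.1 hy
      obtain ⟨b', hb', h⟩ := Finset.mem_vadd_finset.1 hy'
      have := congrArg φ h
      rw [vadd_eq_add, map_add, map_add, hpar a ha, hφ b' hb' b hb] at this
      exact hia (add_right_cancel this)
    have hsub : (A₁ + B₁) ∪ (i +ᵥ B₁) ⊆ (A + B) \ X := by
      apply Finset.union_subset hs₃
      intro y hy
      obtain ⟨b, hb, rfl⟩ := Finset.mem_vadd_finset.1 hy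
      exact hs₁ (Finset.add_mem_add hi hb)
    have hc := Finset.card_le_card hsub
    rw [Finset.card_union_of_disjoint hdisj, Finset.card_vadd_finset] at hc
    have h1 : (A₁ + B₁).card ≤ A₁.card := by omega
    have hmem : i + j ∈ A₁ + B₁ := by
      apply mem_add_of_characters hG ha₀ hb₀
      intro χ hχ
      rcases hB₁χ χ (fun b hb b' hb' => by
        have := hχ _ (vadd_eq_self_of_card_add_le h1 hb hb')
        rwa [map_sub, sub_eq_zero] at this) with h | h
      · rw [h]; rfl
      · rw [h, map_add, map_add]
        exact add_eq_add_of_ne _ _ _ _ hia hφj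
    exact (Finset.mem_sdiff.1 (hs₃ hmem)).2 ((memI i).1 hiI).2
  · push Not at hpar
    obtain ⟨a₁, ha₁, hne⟩ := hpar
    have hψB : ∃ b ∈ B₁, ∃ b' ∈ B₁, ψ b ≠ ψ b' := by
      by_contra hcon
      push Not at hcon
      rcases hB₁χ ψ hcon with h | h
      · exact hψ0 h
      · exact hne (by rw [← h]; exact hψ a₁ ha₁ a₀ ha₀)
    obtain ⟨b, hb, b', hb', hbb'⟩ := hψB
    obtain ⟨x, hx⟩ := hX
    have hmem := mem_add_of_two_characters hG (U := A₁) (V := B₁) (φ := φ) (ψ := ψ)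
      (fun a ha => hψ a ha a₀ ha₀) (fun v hv => hφ v hv b₀ hb₀)
      (exists_apply_eq_of_ne ha₁ ha₀ hne) (exists_apply_eq_of_ne hb hb' hbb') hB₁χ
      ((Finset.card_le_card hs₃).trans hT) x
    exact (Finset.mem_sdiff.1 (hs₃ hmem)).2 hx

/-! ### Replacing A by the complement of the sumset -/

section Duality

theorem Spanning.nonempty {G : Type*} [AddCommGroup G] [Nontrivial G] (hG : ∀ g : G, g + g = 0)
    {S : Finset G} (hS : Spanning S) : S.Nonempty := by
  obtain ⟨g, hg⟩ := _root_.exists_ne (0 : G)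
  obtain ⟨χ, -, hχ⟩ := exists_character_of_notMem hG ⊥ (t := g) (by simpa using hg)
  have hχ0 : χ ≠ 0 := by
    rintro rfl
    exact hχ rfl
  obtain ⟨s, hs, -⟩ := hS.exists_ne hχ0 0
  exact ⟨s, hs⟩

variable {G : Type*} [AddCommGroup G] [Fintype G] [DecidableEq G]

theorem notMem_of_mem_compl_add (hG : ∀ g : G, g + g = 0) {A B : Finset G} {x : G}
    (hx : x ∈ (A + B)ᶜ + B) : x ∉ A := by
  intro hA
  obtain ⟨c, hc, b, hb, rfl⟩ := Finset.mem_add.1 hx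
  rw [Finset.mem_compl] at hc
  exact hc (Finset.mem_add.2 ⟨c + b, hA, b, hb, by rw [add_assoc, hG, add_zero]⟩)

theorem card_compl_add_lt (hG : ∀ g : G, g + g = 0) {A B : Finset G}
    (hAB : (A + B).card < A.card + B.card) :
    ((A + B)ᶜ + B).card < (A + B)ᶜ.card + B.card := by
  have h1 : (A + B)ᶜ + B ⊆ Aᶜ := fun x hx => Finset.mem_compl.2 (notMem_of_mem_compl_add hG hx)
  have h2 := Finset.card_le_card h1
  have h3 := Finset.card_add_card_compl A
  have h4 := Finset.card_add_card_compl (A + B)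
  omega

theorem card_add_card_le_of_notMem_add {A B : Finset G} {x : G} (hx : x ∉ A + B) :
    A.card + B.card ≤ Fintype.card G := by
  have h1 : Disjoint A (B.image (x - ·)) := by
    rw [Finset.disjoint_left]
    intro a ha hb
    obtain ⟨b, hb', rfl⟩ := Finset.mem_image.1 hb
    exact hx (Finset.mem_add.2 ⟨_, ha, b, hb', by simp⟩)
  rw [← Finset.card_image_of_injective B (f := (x - ·)) (fun a b h => by simpa using h),
    ← Finset.card_union_of_disjoint h1]
  exact Finset.card_le_univ _

end Duality

/-! ### Descent to the quotient -/

section Descent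

variable {G Q : Type*} [AddCommGroup G] [Fintype G] [DecidableEq G]
  [AddCommGroup Q] [Fintype Q] [DecidableEq Q] {q : G →+ Q} {A B : Finset G}

namespace FiberMinimal

/-- Since A avoids c + B for c outside A + B, subtracting such a c over k maps this part of A into
the holes of B. -/
theorem card_inter_pre_lt (h : FiberMinimal q B) (hG : ∀ g : G, g + g = 0) {k : Q}
    (hk : k ∈ (A + B)ᶜ.image q) :
    (A ∩ pre q ({k} + B.image q)).card < (fiber q 0).card := by
  refine lt_of_le_of_lt ?_ h.card_sdiff_lt
  obtain ⟨c, hc, rfl⟩ := Finset.mem_image.1 hk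
  apply Finset.card_le_card_of_injOn (fun a => a - c)
  · intro a ha
    simp only [Finset.coe_inter, Set.mem_inter_iff, Finset.mem_coe, mem_pre,
      Finset.singleton_add, Finset.mem_vadd_finset, vadd_eq_add] at ha
    obtain ⟨haA, j, hj, hja⟩ := ha
    simp only [Finset.coe_sdiff, Set.mem_sdiff, Finset.mem_coe, mem_pre, map_sub]
    refine ⟨by rw [← hja, add_sub_cancel_left]; exact hj, fun hB => ?_⟩
    exact notMem_of_mem_compl_add hG (Finset.mem_add.2 ⟨c, hc, _, hB, by simp⟩) haA
  · intro a _ b _ hab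
    simpa using hab

theorem three_le_card_image (h : FiberMinimal q B) (hQ : ∀ g : Q, g + g = 0)
    (hB : Spanning B) (hne : B.Nonempty) : 3 ≤ (B.image q).card := by
  obtain ⟨n, hn⟩ := card_eq_two_pow hQ
  have h1 := (hB.image q h.surj).lt_card hQ (hne.image q) hn
  have h2 : (B.image q).card < Fintype.card Q := (Finset.card_lt_iff_ne_univ _).2 h.ne_univ
  rw [hn] at h2
  by_contra hcon
  have : n < 2 := by omega
  interval_cases n <;> omega

/-- Only |K| - 1 elements of A can lie over k + q(B). With |A| ≥ |B| this gives 2|q(B)| < |Q| + 2,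
which excludes |Q| ≤ 4 by the spanning bound. -/
theorem eight_le_card (h : FiberMinimal q B) (hG : ∀ g : G, g + g = 0)
    (hQ : ∀ g : Q, g + g = 0) (hB : Spanning B) (hBne : B.Nonempty) (hBA : B.card ≤ A.card)
    {k : Q} (hk : k ∈ (A + B)ᶜ.image q) : 8 ≤ Fintype.card Q := by
  obtain ⟨n, hn⟩ := card_eq_two_pow hQ
  have h1 := (hB.image q h.surj).lt_card hQ (hBne.image q) hn
  have h2 := h.card_inter_pre_lt hG hk
  have h3 : (A \ pre q ({k} + B.image q)).card ≤
      (fiber q 0).card * ({k} + B.image q)ᶜ.card := by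
    rw [← card_pre h.surj]
    apply Finset.card_le_card
    intro x hx
    simpa using (Finset.mem_sdiff.1 hx).2
  have h4 := Finset.card_sdiff_add_card_inter A (pre q ({k} + B.image q))
  have h5 := Finset.card_add_card_compl ({k} + B.image q)
  rw [Finset.card_singleton_add] at h5
  have h6 := h.lt
  have h7 : (fiber q 0).card * (B.image q).card <
      (fiber q 0).card * (2 + ({k} + B.image q)ᶜ.card) := by
    rw [mul_add]
    omega
  have h8 := lt_of_mul_lt_mul_left h7 (Nat.zero_le _)
  have h9 := h.three_le_card_image hQ hB hBne
  rw [hn] at h5 ⊢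
  have h10 : 3 ≤ n := by
    by_contra hcon
    interval_cases n <;> omega
  calc 8 = 2 ^ 3 := by norm_num
    _ ≤ 2 ^ n := Nat.pow_le_pow_right (by norm_num) h10

/-- Only the case q(C) + q(B) = Q needs work. Fill one fiber of C over k and take the complement E
of the new sumset with B. Then q(E) + q(B) misses k, so the equality holds for E and
`exists_common_fiber` applies to it. -/
theorem card_compl_image_add (h : FiberMinimal q B) (hG : ∀ g : G, g + g = 0)
    (hQ : ∀ g : Q, g + g = 0) (hB : Spanning B) (hBne : B.Nonempty) (hBA : B.card ≤ A.card)
    (hAB : (A + B).card < A.card + B.card) (hC2 : 2 ≤ ((A + B)ᶜ.image q).card) :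
    ((A + B)ᶜ.image q + B.image q).card + 1 = ((A + B)ᶜ.image q).card + (B.image q).card := by
  set C := (A + B)ᶜ with hC
  have hCcrit : (C + B).card < C.card + B.card := card_compl_add_lt hG hAB
  have hL := h.card_image_add_lt hCcrit
  have hCne : (C.image q).Nonempty := Finset.card_pos.1 (by omega)
  by_cases hu : C.image q + B.image q = Finset.univ
  swap
  · have := h.le_card_add_image hCne hu
    omega
  by_contra hnt
  obtain ⟨k, hk⟩ := hCne
  have hfB : fiber q k + B = pre q ({k} + B.image q) := by rw [← pre_singleton, pre_add]
  set C' := C ∪ fiber q k with hC'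
  have hC'crit : (C' + B).card < C'.card + B.card := by
    have := h.card_union_fiber_add_le hk
    rw [← hC'] at this
    omega
  set E := (C' + B)ᶜ with hE
  have hEcrit : (E + B).card < E.card + B.card := card_compl_add_lt hG hC'crit
  have hAE : A \ pre q ({k} + B.image q) ⊆ E := by
    intro a ha
    obtain ⟨ha, hap⟩ := Finset.mem_sdiff.1 ha
    rw [hE, Finset.mem_compl, hC', Finset.union_add, Finset.mem_union, hfB]
    rintro (h1 | h1)
    · exact notMem_of_mem_compl_add hG h1 ha
    · exact hap h1
  have hE2 : 2 ≤ (E.image q).card := by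
    have h1 := Finset.card_le_card hAE
    have h2 := h.card_inter_pre_lt hG hk
    have h3 := Finset.card_sdiff_add_card_inter A (pre q ({k} + B.image q))
    have h4 := h.lt
    have h5 := h.three_le_card_image hQ hB hBne
    have h6 : (fiber q 0).card * 3 ≤ (fiber q 0).card * (B.image q).card :=
      Nat.mul_le_mul_left _ h5
    have h7 : E.card ≤ (fiber q 0).card * (E.image q).card := by
      rw [← card_pre h.surj]
      exact Finset.card_le_card (subset_pre_image E)
    by_contra hcon
    have h8 : (fiber q 0).card * (E.image q).card ≤ (fiber q 0).card * 1 :=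
      Nat.mul_le_mul_left _ (by omega)
    omega
  have hEu : E.image q + B.image q ≠ Finset.univ := by
    intro hu'
    obtain ⟨y, hy, j, hj, hyj⟩ := Finset.mem_add.1 (hu' ▸ Finset.mem_univ k)
    obtain ⟨e, he, rfl⟩ := Finset.mem_image.1 hy
    rw [hE, Finset.mem_compl, hC', Finset.union_add, Finset.mem_union, not_or, hfB, mem_pre] at he
    apply he.2
    exact Finset.mem_add.2 ⟨k, Finset.mem_singleton_self k, j, hj, by
      rw [← hyj, add_assoc, hQ, add_zero]⟩
  have hEne : (E.image q).Nonempty := Finset.card_pos.1 (by omega)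
  have hEt : (E.image q + B.image q).card + 1 = (E.image q).card + (B.image q).card := by
    have h1 := h.le_card_add_image hEne hEu
    have h2 := h.card_image_add_lt hEcrit
    omega
  obtain ⟨j₀, hj₀⟩ := h.exists_common_fiber hEcrit hEt hE2
  obtain ⟨y, hy⟩ := hEne
  have hrep : ∀ j ∈ B.image q ∩ (C.image q).image (y - ·), j = j₀ := by
    intro j hj
    obtain ⟨hj, hjC⟩ := Finset.mem_inter.1 hj
    obtain ⟨c', hc', rfl⟩ := Finset.mem_image.1 hjC
    obtain ⟨c, hc, rfl⟩ := Finset.mem_image.1 hc'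
    refine hj₀ y hy _ hj c (fun hcE => ?_) ?_
    · exact notMem_of_mem_compl_add hG hcE (Finset.mem_union_left _ hc)
    · rw [← add_sub_assoc, hQ, zero_sub, neg_eq_self_of_add_self hQ]
  have hle1 : (B.image q ∩ (C.image q).image (y - ·)).card ≤ 1 :=
    Finset.card_le_one.2 (fun a ha b hb => (hrep a ha).trans (hrep b hb).symm)
  -- If equality failed, |q(B)| + |q(C)| ≥ |Q| + 2 would give two choices of j.
  have h1 := Finset.card_union_add_card_inter (B.image q) ((C.image q).image (y - ·))
  have h2 := Finset.card_le_univ (B.image q ∪ (C.image q).image (y - ·))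
  rw [Finset.card_image_of_injective (C.image q) (f := (y - ·)) (fun a b h => by simpa using h)]
    at h1
  rw [hu, Finset.card_univ] at hnt hL
  omega

/-- Either the complement of `A + B` lies in one of at least eight fibers, or the problem descends
to the quotient. -/
theorem exists_descent (h : FiberMinimal q B) (hG : ∀ g : G, g + g = 0)
    (hQ : ∀ g : Q, g + g = 0) (hA : Spanning A) (hB : Spanning B) (hBne : B.Nonempty)
    (hBA : B.card ≤ A.card) (hAB : (A + B).card < A.card + B.card) (hC : (A + B)ᶜ.Nonempty) :
    (8 ≤ Fintype.card Q ∧ ∀ x ∉ A + B, ∀ y ∉ A + B, q x = q y) ∨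
      ∃ A' B' : Finset Q, Spanning A' ∧ Spanning B' ∧ (A' + B').card < A'.card + B'.card ∧
        ∀ x ∉ A + B, q x ∉ A' + B' := by
  have hmem : ∀ x ∉ A + B, q x ∈ (A + B)ᶜ.image q := fun x hx =>
    Finset.mem_image_of_mem q (Finset.mem_compl.2 hx)
  by_cases hC2 : 2 ≤ ((A + B)ᶜ.image q).card
  swap
  · left
    have h1 : ((A + B)ᶜ.image q).card ≤ 1 := by omega
    rw [Finset.card_le_one] at h1
    obtain ⟨k, hk⟩ := hC.image q
    exact ⟨h.eight_le_card hG hQ hB hBne hBA hk,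
      fun x hx y hy => h1 _ (hmem x hx) _ (hmem y hy)⟩
  right
  have hAB' := h.card_image_add_lt hAB
  obtain ⟨j₀, hj₀⟩ := h.exists_common_fiber (card_compl_add_lt hG hAB)
    (h.card_compl_image_add hG hQ hB hBne hBA hAB hC2) hC2
  set X := (A + B)ᶜ.image q ∩ (A.image q + B.image q) with hX
  rcases X.eq_empty_or_nonempty with hXe | hXne
  · refine ⟨A.image q, B.image q, hA.image q h.surj, hB.image q h.surj, hAB', fun x hx hx' => ?_⟩
    have : q x ∈ X := Finset.mem_inter.2 ⟨hmem x hx, hx'⟩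
    rw [hXe] at this
    simp at this
  · have hXj : ∀ a ∈ A.image q, ∀ b ∈ B.image q, a + b ∈ X → b = j₀ := by
      intro a' ha' b hb hab
      obtain ⟨a, ha, rfl⟩ := Finset.mem_image.1 ha'
      exact hj₀ _ (Finset.mem_inter.1 hab).1 b hb a
        (fun hcon => notMem_of_mem_compl_add hG hcon ha) (by rw [add_assoc, hQ, add_zero])
    have hj : j₀ ∈ B.image q := by
      obtain ⟨x, hx⟩ := hXne
      obtain ⟨a, ha, b, hb, rfl⟩ := Finset.mem_add.1 (Finset.mem_inter.1 hx).2
      rwa [← hXj a ha b hb hx]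
    obtain ⟨A', B', hA', hB', hs, hc⟩ := exists_spanning_subpair hQ (hA.image q h.surj)
      (hB.image q h.surj) hAB' hj hXne Finset.inter_subset_right hXj
    refine ⟨A', B', hA', hB', hc, fun x hx hx' => ?_⟩
    have := Finset.mem_sdiff.1 (hs hx')
    exact this.2 (Finset.mem_inter.2 ⟨hmem x hx, this.1⟩)

end FiberMinimal

end Descent

/-! ### The induction on the order of the group -/

section Main

universe u

theorem exists_fiberMinimal {G : Type u} [AddCommGroup G] [Fintype G] [DecidableEq G]
    (hG : ∀ g : G, g + g = 0) {A B : Finset G} (hB : B.Nonempty) (h2 : 2 ≤ A.card)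
    (hAB : (A + B).card < A.card + B.card) (hC : (A + B).card + 2 ≤ Fintype.card G) :
    ∃ (Q : Type u) (_ : AddCommGroup Q) (_ : Fintype Q) (_ : DecidableEq Q) (q : G →+ Q),
      FiberMinimal q B := by
  classical
  obtain ⟨M, K, hMK, hM2, hMB, hmin⟩ := exists_subgroup_minimizer hG hB h2 hC
  refine ⟨G ⧸ K, inferInstance, Fintype.ofFinite _, inferInstance, QuotientAddGroup.mk' K, ?_⟩
  let _ : Fintype (G ⧸ K) := Fintype.ofFinite _
  set q := QuotientAddGroup.mk' K with hq
  have hsurj : Function.Surjective q := QuotientAddGroup.mk'_surjective K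
  have hM : fiber q 0 = M := by
    ext x
    rw [mem_fiber, hMK, hq, QuotientAddGroup.mk'_apply, QuotientAddGroup.eq_zero_iff]
  have hMBe : M + B = pre q (B.image q) := by
    rw [← hM, ← pre_singleton, pre_add, Finset.singleton_zero, zero_add]
  have hMBc : (M + B).card = (fiber q 0).card * (B.image q).card := by
    rw [hMBe, card_pre hsurj]
  have hlt : (fiber q 0).card * (B.image q).card < (fiber q 0).card + B.card := by
    have := hmin A h2 hC
    rw [← hMBc, hM]
    omega
  refine ⟨hsurj, by rw [hM]; exact hM2, ?_, ?_, hlt⟩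
  · intro hu
    have : (M + B).card = Fintype.card G := by
      rw [hMBc, hu, Finset.card_univ, card_univ_eq hsurj]
    omega
  · intro X hX hXB
    by_cases hX2 : 2 ≤ X.card
    · have := hmin X hX2 hXB
      rwa [← hMBc, hM]
    -- Singletons, excluded from the minimisation, are covered by `hlt`.
    · have h1 : B.card ≤ (X + B).card := Finset.card_le_card_add_left hX
      omega

theorem eight_le_card_of_notMem_add {G : Type*} [AddCommGroup G] [Fintype G] [DecidableEq G]
    (hG : ∀ g : G, g + g = 0) {A B : Finset G} (hA : Spanning A) (hB : Spanning B)
    (hAne : A.Nonempty) (hBne : B.Nonempty) {x : G} (hx : x ∉ A + B) :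
    8 ≤ Fintype.card G ∧ 4 ≤ A.card ∧ 4 ≤ B.card := by
  obtain ⟨n, hn⟩ := card_eq_two_pow hG
  have h1 := hA.lt_card hG hAne hn
  have h2 := hB.lt_card hG hBne hn
  have h3 := card_add_card_le_of_notMem_add hx
  have h4 : 3 ≤ n := three_le_of_two_mul_add_two_le_two_pow (by omega)
  refine ⟨?_, by omega, by omega⟩
  calc 8 = 2 ^ 3 := by norm_num
    _ ≤ 2 ^ n := Nat.pow_le_pow_right (by norm_num) h4
    _ = _ := hn.symm

/-- The index is only bounded below because the terminal cases produce ⊥ or a kernel of possibly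
larger index; `exists_le_index_eq_eight` enlarges the subgroup afterwards. -/
theorem exists_subgroup_index_ge_of_card_eq (n : ℕ) :
    ∀ (G : Type u) [AddCommGroup G] [Fintype G] [DecidableEq G] (_ : ∀ g : G, g + g = 0)
      (A B : Finset G), Fintype.card G = n → Spanning A → Spanning B → A.Nonempty → B.Nonempty →
      (A + B).card < A.card + B.card → (A + B)ᶜ.Nonempty →
      ∃ D : AddSubgroup G, 8 ≤ D.index ∧ ∀ x ∉ A + B, ∀ y ∉ A + B, x - y ∈ D := by
  induction n using Nat.strong_induction_on with
  | _ n ih =>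
  intro G _ _ _ hG A B hn hA hB hAne hBne hAB hC
  wlog hBA : B.card ≤ A.card generalizing A B
  · have := this B A hB hA hBne hAne (by rw [add_comm B, add_comm B.card]; exact hAB)
      (by rwa [add_comm B]) (by omega)
    rwa [add_comm B] at this
  obtain ⟨x₀, hx₀⟩ := hC
  rw [Finset.mem_compl] at hx₀
  obtain ⟨h8, hA4, -⟩ := eight_le_card_of_notMem_add hG hA hB hAne hBne hx₀
  by_cases hC1 : (A + B)ᶜ.card ≤ 1
  · refine ⟨⊥, by rwa [AddSubgroup.index_bot, Nat.card_eq_fintype_card], fun x hx y hy => ?_⟩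
    rw [Finset.card_le_one.1 hC1 x (Finset.mem_compl.2 hx) y (Finset.mem_compl.2 hy), sub_self]
    exact zero_mem _
  have hcc := Finset.card_add_card_compl (A + B)
  obtain ⟨Q, _, _, _, q, hmin⟩ := exists_fiberMinimal hG hBne (by omega) hAB (by omega)
  have hQ : ∀ g : Q, g + g = 0 := by
    intro g
    obtain ⟨x, rfl⟩ := hmin.surj g
    rw [← map_add, hG, map_zero]
  rcases hmin.exists_descent hG hQ hA hB hBne hBA hAB ⟨x₀, Finset.mem_compl.2 hx₀⟩ with
    ⟨h1, h2⟩ | ⟨A', B', hA', hB', hAB', hsub⟩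
  · refine ⟨q.ker, ?_, fun x hx y hy => ?_⟩
    · rwa [AddSubgroup.index_ker, AddMonoidHom.range_eq_top.2 hmin.surj, AddSubgroup.card_top,
        Nat.card_eq_fintype_card]
    · rw [AddMonoidHom.mem_ker, map_sub, h2 x hx y hy, sub_self]
  · have hQn : Nontrivial Q := by
      rw [← Fintype.one_lt_card_iff_nontrivial]
      have h1 := hmin.three_le_card_image hQ hB hBne
      have h2 := Finset.card_le_univ (B.image q)
      omega
    have hlt : Fintype.card Q < n := by
      rw [← hn, card_univ_eq hmin.surj]
      have h1 := hmin.two_le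
      have h2 : 0 < Fintype.card Q := Fintype.card_pos
      nlinarith
    obtain ⟨D, hD8, hD⟩ := ih _ hlt Q hQ A' B' rfl hA' hB' (hA'.nonempty hQ) (hB'.nonempty hQ) hAB'
      ⟨q x₀, Finset.mem_compl.2 (hsub x₀ hx₀)⟩
    refine ⟨D.comap q, by rwa [AddSubgroup.index_comap_of_surjective _ hmin.surj], ?_⟩
    intro x hx y hy
    rw [AddSubgroup.mem_comap, map_sub]
    exact hD _ (hsub x hx) _ (hsub y hy)

end Main

theorem exists_le_index_eq_eight {G : Type*} [AddCommGroup G] [Fintype G]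
    (hG : ∀ g : G, g + g = 0) (D : AddSubgroup G) (hD : 8 ≤ D.index) :
    ∃ H : AddSubgroup G, D ≤ H ∧ H.index = 8 := by
  obtain ⟨n, hn⟩ := card_eq_two_pow hG
  rw [← Nat.card_eq_fintype_card] at hn
  obtain ⟨m, -, hm⟩ := (Nat.dvd_prime_pow Nat.prime_two).1 (hn ▸ D.card_addSubgroup_dvd_card)
  have hDi := D.card_mul_index
  rw [hn, hm] at hDi
  have hmn : m + 3 ≤ n := by
    have h1 : 2 ^ (m + 3) ≤ 2 ^ n := by
      rw [← hDi, pow_add]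
      exact Nat.mul_le_mul_left _ (by simpa using hD)
    exact (Nat.pow_le_pow_iff_right (by norm_num)).1 h1
  obtain ⟨K, hK, hDK⟩ := Sylow.exists_subgroup_card_pow_prime_le (G := Multiplicative G) 2
    (n := m) (m := n - 3) (by
      have : Nat.card (Multiplicative G) = 2 ^ n := hn
      rw [this]
      exact pow_dvd_pow _ (by omega)) (AddSubgroup.toSubgroup D) hm (by omega)
  refine ⟨AddSubgroup.toSubgroup.symm K, fun x hx => hDK hx, ?_⟩
  have h1 := (AddSubgroup.toSubgroup.symm K).card_mul_index
  have h2 : Nat.card (AddSubgroup.toSubgroup.symm K) = 2 ^ (n - 3) := hK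
  have h3 : 2 ^ n = 2 ^ (n - 3) * 8 := by
    rw [show (8 : ℕ) = 2 ^ 3 by norm_num, ← pow_add]
    congr 1
    omega
  rw [h2, hn, h3] at h1
  exact Nat.eq_of_mul_eq_mul_left (by positivity) h1

/-! ### Multiplicities when the complement is a full coset -/

theorem even_card_filter_add_mem {Q : Type*} [AddCommGroup Q] [DecidableEq Q]
    (hQ : ∀ g : Q, g + g = 0) (S : Finset Q) {t : Q} (ht : t ≠ 0) :
    Even (S.filter (fun s => t + s ∈ S)).card := by
  rw [← ZMod.natCast_eq_zero_iff_even, Finset.card_eq_sum_ones, Nat.cast_sum]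
  refine Finset.sum_involution (fun s _ => t + s) ?_ ?_ ?_ ?_
  · intro a _
    decide
  · intro a _ _ h
    exact ht (by simpa using h)
  · intro a ha
    rw [Finset.mem_filter] at ha ⊢
    exact ⟨ha.2, by rw [add_add_cancel_of_add_self hQ]; exact ha.1⟩
  · intro a _
    exact add_add_cancel_of_add_self hQ t a

/-- In a group of order eight, the elements of a sumset of two spanning sets that misses exactly
one element all have at least two representations. -/
theorem two_le_card_representations {Q : Type*} [AddCommGroup Q] [Fintype Q] [DecidableEq Q]
    (hQ : ∀ g : Q, g + g = 0) {A B : Finset Q} (hA : A.card = 4) (hB : B.card = 4)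
    (hQ8 : Fintype.card Q = 8) {x y : Q} (hx : x ∉ A + B) (hy : y ∈ A + B) :
    2 ≤ (A.filter (fun a => y - a ∈ B)).card := by
  have hinj : Function.Injective (x - · : Q → Q) := fun a b h => by simpa using h
  have hBeq : B = (A.image (x - ·))ᶜ := by
    apply Finset.eq_of_subset_of_card_le
    · intro b hb
      rw [Finset.mem_compl]
      intro h
      obtain ⟨a, ha, rfl⟩ := Finset.mem_image.1 h
      exact hx (Finset.mem_add.2 ⟨a, ha, _, hb, by simp⟩)
    · rw [Finset.card_compl, Finset.card_image_of_injective _ hinj]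
      omega
  have ht : x - y ≠ 0 := fun h => hx (by rwa [sub_eq_zero.1 h])
  -- As B is the complement of x - A, the elements of A giving no representation of y are those kept
  -- in A by translation by x - y. Their number is even and |A| = 4, so the positive number left is
  -- at least 2.
  have hiff : ∀ a, y - a ∈ B ↔ (x - y) + a ∉ A := by
    intro a
    rw [hBeq, Finset.mem_compl, not_iff_not, Finset.mem_image]
    constructor
    · rintro ⟨c, hc, h⟩
      have : (x - y) + a = c := by
        rw [← sub_eq_zero] at h ⊢
        rw [← h]
        abel
      rwa [this]
    · intro h
      exact ⟨_, h, by abel⟩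
  have hev := even_card_filter_add_mem hQ A ht
  have hsum := Finset.card_filter_add_card_filter_not (s := A) (fun a => (x - y) + a ∈ A)
  simp only [hiff]
  have hpos : 0 < (A.filter (fun a => (x - y) + a ∉ A)).card := by
    obtain ⟨a, ha, b, hb, rfl⟩ := Finset.mem_add.1 hy
    refine Finset.card_pos.2 ⟨a, Finset.mem_filter.2 ⟨ha, (hiff a).1 ?_⟩⟩
    rwa [add_sub_cancel_left]
  obtain ⟨r, hr⟩ := hev
  omega

theorem two_le_nu {G Q : Type*} [AddCommGroup G] [Fintype G] [DecidableEq G] [AddCommGroup Q]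
    [Fintype Q] [DecidableEq Q] {q : G →+ Q} (hq : Function.Surjective q)
    (hQ : ∀ g : Q, g + g = 0) {A B : Finset G} (hA : Spanning A) (hB : Spanning B)
    (hAne : A.Nonempty) (hBne : B.Nonempty) (hQ8 : Fintype.card Q = 8) {x : Q}
    (hx : (A + B)ᶜ = fiber q x) (hAB : (A + B).card < A.card + B.card) {g : G}
    (hg : g ∈ A + B) : 2 ≤ nu A B g := by
  set N := (fiber q 0).card with hN
  have hxn : x ∉ A.image q + B.image q := by
    rw [← Finset.image_add]
    intro h
    obtain ⟨z, hz, hzx⟩ := Finset.mem_image.1 h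
    exact Finset.mem_compl.1 (hx ▸ (mem_fiber q).2 hzx) hz
  obtain ⟨-, hA4, hB4⟩ := eight_le_card_of_notMem_add hQ (hA.image q hq) (hB.image q hq)
    (hAne.image q) (hBne.image q) hxn
  have hle := card_add_card_le_of_notMem_add hxn
  obtain ⟨i₁, hi₁, i₂, hi₂, hne⟩ := Finset.one_lt_card.1 (two_le_card_representations hQ
    (A := A.image q) (B := B.image q) (by omega) (by omega) hQ8 hxn (y := q g)
    (by rw [← Finset.image_add]; exact Finset.mem_image_of_mem q hg))
  rw [Finset.mem_filter] at hi₁ hi₂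
  have hAc := card_pre_sdiff hq A
  have hBc := card_pre_sdiff hq B
  rw [show (A.image q).card = 4 by omega] at hAc
  rw [show (B.image q).card = 4 by omega] at hBc
  have hGc := card_univ_eq hq
  have hcc := Finset.card_add_card_compl (A + B)
  rw [hx, card_fiber hq] at hcc
  rw [hQ8] at hGc
  set U := fiber q i₁ ∪ fiber q i₂ with hU
  have hUc : U.card = N + N := by
    rw [hU, Finset.card_union_of_disjoint, card_fiber hq i₁, card_fiber hq i₂]
    rw [Finset.disjoint_left]
    intro a ha ha'
    rw [mem_fiber] at ha ha'
    exact hne (ha.symm.trans ha')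
  have hUmem : ∀ a ∈ U, q a ∈ A.image q ∧ q (g - a) ∈ B.image q := by
    intro a ha
    rw [hU, Finset.mem_union, mem_fiber, mem_fiber] at ha
    rw [map_sub]
    rcases ha with rfl | rfl
    exacts [hi₁, hi₂]
  -- Two fibers offer 2N candidates for the first summand; each failure is charged to a hole of A or
  -- of B, and there are fewer than N holes.
  have hbad : (U.filter (fun a => ¬ (a ∈ A ∧ g - a ∈ B))).card ≤
      (pre q (A.image q) \ A).card + (pre q (B.image q) \ B).card := by
    have hsub : U.filter (fun a => ¬ (a ∈ A ∧ g - a ∈ B)) ⊆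
        (pre q (A.image q) \ A) ∪ (pre q (B.image q) \ B).image (g - ·) := by
      intro a ha
      obtain ⟨haU, hab⟩ := Finset.mem_filter.1 ha
      have h1 := hUmem a haU
      rw [Finset.mem_union]
      by_cases haA : a ∈ A
      · right
        exact Finset.mem_image.2 ⟨g - a, Finset.mem_sdiff.2
          ⟨(mem_pre q).2 h1.2, fun h => hab ⟨haA, h⟩⟩, by abel⟩
      · exact Or.inl (Finset.mem_sdiff.2 ⟨(mem_pre q).2 h1.1, haA⟩)
    exact (Finset.card_le_card hsub).trans ((Finset.card_union_le _ _).trans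
      (Nat.add_le_add_left Finset.card_image_le _))
  have hgood : (U.filter (fun a => a ∈ A ∧ g - a ∈ B)).card ≤ nu A B g := by
    apply Finset.card_le_card_of_injOn (fun a => (a, g - a))
    · intro a ha
      have := (Finset.mem_filter.1 ha).2
      exact Finset.mem_filter.2 ⟨Finset.mem_product.2 this, by simp⟩
    · intro a _ b _ h
      exact (Prod.mk.inj h).1
  have hsum := Finset.card_filter_add_card_filter_not (s := U) (fun a => a ∈ A ∧ g - a ∈ B)
  have hNpos : 0 < N := Finset.card_pos.2 ⟨0, by simp⟩
  omega

theorem mu_ne_one {G : Type*} [AddCommGroup G] [Fintype G] [DecidableEq G]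
    (hG : ∀ g : G, g + g = 0) {A B : Finset G} (hA : Spanning A) (hB : Spanning B)
    (hAne : A.Nonempty) (hBne : B.Nonempty) (hAB : (A + B).card < A.card + B.card)
    {H : AddSubgroup G} (hH : H.index = 8) {c : G}
    (hc : ((A + B : Finset G) : Set G)ᶜ = c +ᵥ (H : Set G)) : mu A B ≠ 1 := by
  classical
  intro hmu
  obtain ⟨g, hg, hnu⟩ : (1 : ℕ) ∈ {m : ℕ | ∃ g ∈ A + B, nu A B g = m} := by
    rw [← hmu]
    obtain ⟨g, hg⟩ := hAne.add hBne
    exact Nat.sInf_mem ⟨_, g, hg, rfl⟩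
  let _ : Fintype (G ⧸ H) := Fintype.ofFinite _
  have hq : Function.Surjective (QuotientAddGroup.mk' H) := QuotientAddGroup.mk'_surjective H
  have hQ : ∀ y : G ⧸ H, y + y = 0 := by
    intro y
    obtain ⟨x, rfl⟩ := hq y
    rw [← map_add, hG, map_zero]
  have := two_le_nu hq hQ hA hB hAne hBne
    (by rw [← Nat.card_eq_fintype_card]; exact hH) (x := QuotientAddGroup.mk' H c) (by
      ext z
      have : z ∈ ((A + B : Finset G) : Set G)ᶜ ↔ z ∈ c +ᵥ (H : Set G) := by rw [hc]
      rw [Set.mem_vadd_set_iff_neg_vadd_mem] at this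
      rw [Finset.mem_compl, mem_fiber, eq_comm, QuotientAddGroup.mk'_apply,
        QuotientAddGroup.mk'_apply, QuotientAddGroup.eq]
      exact this) hAB hg
  omega

end SmallSumset

theorem theorem1 {G : Type*} [AddCommGroup G] [Fintype G] [DecidableEq G]
    (hG : ∀ g : G, g + g = 0) (A B : Finset G) (hA : A.Nonempty) (hB : B.Nonempty)
    (hAspan : SmallSumset.affSpan (A : Set G) = Set.univ)
    (hBspan : SmallSumset.affSpan (B : Set G) = Set.univ)
    (hAB : (A + B).card < min (A.card + B.card) (Fintype.card G)) :
    (∃ (H : AddSubgroup G) (C : Set G), H.index = 8 ∧ SmallSumset.IsCosetOf H C ∧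
        ((A + B : Finset G) : Set G)ᶜ ⊆ C) ∧
      (7 / 8 : ℝ) * (Fintype.card G : ℝ) ≤ ((A + B).card : ℝ) ∧
      (SmallSumset.mu A B = 1 →
        ∀ (H : AddSubgroup G) (C : Set G), H.index = 8 → SmallSumset.IsCosetOf H C →
          ((A + B : Finset G) : Set G)ᶜ ⊆ C → ((A + B : Finset G) : Set G)ᶜ ⊂ C) := by
  classical
  have hAs := SmallSumset.spanning_of_affSpan_eq_univ hA hAspan
  have hBs := SmallSumset.spanning_of_affSpan_eq_univ hB hBspan
  obtain ⟨hlt, hlt'⟩ := lt_min_iff.1 hAB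
  have hcc := Finset.card_add_card_compl (A + B)
  obtain ⟨c, hc⟩ : (A + B)ᶜ.Nonempty := Finset.card_pos.1 (by omega)
  obtain ⟨D, hD8, hD⟩ := SmallSumset.exists_subgroup_index_ge_of_card_eq _ G hG A B rfl hAs hBs
    hA hB hlt ⟨c, hc⟩
  obtain ⟨H, hDH, hH⟩ := SmallSumset.exists_le_index_eq_eight hG D hD8
  have hsub : ∀ x ∉ A + B, x - c ∈ H := fun x hx => hDH (hD x hx c (Finset.mem_compl.1 hc))
  refine ⟨⟨H, c +ᵥ (H : Set G), hH, ⟨c, rfl⟩, fun x hx => ?_⟩, ?_, ?_⟩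
  · rw [Set.mem_vadd_set_iff_neg_vadd_mem, vadd_eq_add, neg_add_eq_sub]
    exact hsub x (fun h => hx (Finset.mem_coe.2 h))
  · have h1 : (A + B)ᶜ.card ≤ Nat.card H := by
      rw [← Nat.subtype_card (p := (· ∈ (A + B)ᶜ)) _ (fun _ => Iff.rfl)]
      exact Nat.card_le_card_of_injective
        (fun x : {x // x ∈ (A + B)ᶜ} => (⟨x.1 - c, hsub x.1 (Finset.mem_compl.1 x.2)⟩ : H))
        (fun x y h => Subtype.ext (sub_left_injective (congrArg Subtype.val h)))
    have h2 := H.card_mul_index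
    rw [hH, Nat.card_eq_fintype_card (α := G)] at h2
    have h3 : 7 * Fintype.card G ≤ 8 * (A + B).card := by omega
    have h4 : (7 : ℝ) * Fintype.card G ≤ 8 * (A + B).card := by exact_mod_cast h3
    linarith
  · rintro hmu K C hK ⟨d, rfl⟩ hKC
    refine lt_of_le_of_ne hKC fun heq => ?_
    exact SmallSumset.mu_ne_one hG hAs hBs hA hB hlt hK heq hmu
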